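/- Let $M\ge 1$ and $\lambda\in\mathbb{C}$, and let $P(x,\frac{d}{dx})=\sum_{m=0}^M p_m(x)(\frac{d}{dx})^m$ with complex-valued coefficients $p_m\in C^M(\mathbb{R})$ (for instance polynomials). Assume that $P$ has no singular points, i.e. $p_M(x)\neq 0$ for all $x\in\mathbb{R}$. Put $P(\lambda;x,\frac{d}{dx})=P(x,\frac{d}{dx})-\lambda I$. A Hilbert function space on $\mathbb{R}$ is a complex Hilbert space whose elements are measurable functions $\mathbb{R}\to\mathbb{C}$ modulo equality almost everywhere, with the pointwise linear structure, such that every norm-convergent sequence has a subsequence converging almost everywhere to the limit. Such a class "belongs to $C^r(\mathbb{R})$" if it has a (necessarily unique) representative in $C^r(\mathbb{R})$, on which differential operators then act. Let $\mathcal{H}$ and $\mathcal{H}^\Diamond$ be Hilbert function spaces on $\mathbb{R}$ with $\mathcal{H}\subset\mathcal{H}^\Diamond$ as sets (the inner products may differ), and let $\{e_n\}_{n\ge 0}$ and $\{e_n^\Diamond\}_{n\ge 0}$ be orthonormal bases of $\mathcal{H}$ and $\mathcal{H}^\Diamond$. Inner products are linear in the first argument. Let $\widetilde A_{P,\mathcal{H}}$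 be the action of $P(x,\frac{d}{dx})$ as an operator in $\mathcal{H}$ with domain $\{f\in C^M(\mathbb{R})\cap\mathcal{H} : P(x,\frac{d}{dx})f\in\mathcal{H}\}$, let $\widetilde B$ be the action of $P(\lambda;x,\frac{d}{dx})$ as an operator from $\mathcal{H}$ to $\mathcal{H}^\Diamond$ with domain $\{f\in C^M(\mathbb{R})\cap\mathcal{H} : P(\lambda;x,\frac{d}{dx})f\in\mathcal{H}^\Diamond\}$, and let $A_{P,\mathcal{H}}$ and $B$ be their closures in the graph norms. Assume: * (C1) $e_n\in D(\widetilde B)$ for all $n\ge 0$. * (C2) There is an integer $\ell_0$ such that $b_m^n:=\langle Be_n,e_m^\Diamond\rangle_{\mathcal{H}^\Diamond}=0$ whenever $|n-m|>\ell_0$. * (C2$^+$) There is a positive function $\upsilon^\Diamond\in C^M(\mathbb{R})$ such that $\langle f,g\rangle_{\mathcal{H}^\Diamond}=\int_{\mathbb{R}} f\,\overline{g}\,\upsilon^\Diamond\,dx$ (with integrable integrand) for all $f,g\in\mathcal{H}^\Diamond$. * (C2.1) $\sup_{m\ge 0,\,n\ge 1}|b_m^n|/n^M<\infty$. * (C2.2)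 All $e_n^\Diamond$ belong to $C^M(\mathbb{R})$, and there are complex-valued functions $n_1,n_0\in C^{M-1}(\mathbb{R})$ and real numbers $\lambda_n$ such that $n_1\frac{d}{dx}e_n^\Diamond+n_0e_n^\Diamond=\lambda_ne_n^\Diamond$ on $\mathbb{R}$ for all $n\ge 0$ and $\liminf_{n\to\infty}|\lambda_n|/n>0$ (the value $+\infty$ is allowed). * (C2.3) There is a continuous function $\tilde a$ on $\mathbb{R}$ with $|e_n^\Diamond(x)|\le\tilde a(x)$ for all $n\ge 0$ and $x\in\mathbb{R}$. * (C3) There is a linear operator $C$ from a dense subspace $D(C)$ of $\mathcal{H}^\Diamond$ to $\mathcal{H}$ such that, for all $m\ge 0$, $e_m^\Diamond\in D(C)$ and $\langle Bf,e_m^\Diamond\rangle_{\mathcal{H}^\Diamond}=\langle f,Ce_m^\Diamond\rangle_{\mathcal{H}}$ for all $f\in D(\widetilde B)$. Let $V$ be the space of all complex sequences $\{f_n\}_{n\ge 0}$ with $\sum_{n=0}^\infty b_m^nf_n=0$ for every $m\ge 0$. Then $\widetilde A_{P,\mathcal{H}}$ and $\widetilde B$ are closable, and for every $f\in\mathcal{H}$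 the following conditions are equivalent: 1. $f\in\operatorname{dom}A_{P,\mathcal{H}}$ and $A_{P,\mathcal{H}}f=\lambda f$; 2. $f\in\operatorname{dom}B$ and $Bf=0$; 3. $\{\langle f,e_n\rangle_{\mathcal{H}}\}_{n\ge 0}\in V\cap\ell^2$; 4. $f\in C^M(\mathbb{R})\cap\mathcal{H}$ and $P(x,\frac{d}{dx})f(x)=\lambda f(x)$ for all $x\in\mathbb{R}$. -/

import Mathlib

open MeasureTheory Filter Topology
open scoped ComplexConjugate

noncomputable section

/-- A realization of the Hilbert space `H` as a space of complex functions on the real line: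
its elements are classes modulo a.e. equality of measurable functions, with the pointwise linear
structure, and every norm-convergent sequence has a subsequence that converges almost everywhere
(as in every weighted `L²` space). -/
structure FunctionSpace (H : Type*) [NormedAddCommGroup H] [InnerProductSpace ℂ H] where
  toFun : H →ₗ[ℂ] (ℝ →ₘ[volume] ℂ)
  injective : Function.Injective toFun
  exists_subseq_tendsto_ae : ∀ (u : ℕ → H) (f : H), Tendsto u atTop (𝓝 f) →
    ∃ φ : ℕ → ℕ, StrictMono φ ∧
      ∀ᵐ x : ℝ, Tendsto (fun k => toFun (u (φ k)) x) atTop (𝓝 (toFun f x))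

/-- `F` is a representative of the element `f` of the function space. -/
def FunctionSpace.Rep {H : Type*} [NormedAddCommGroup H] [InnerProductSpace ℂ H]
    (J : FunctionSpace H) (f : H) (F : ℝ → ℂ) : Prop :=
  J.toFun f =ᵐ[volume] F

/-- The inclusion of `H` in `K` as sets of (classes of) functions. -/
def FunctionSpace.Subset {H K : Type*} [NormedAddCommGroup H] [InnerProductSpace ℂ H]
    [NormedAddCommGroup K] [InnerProductSpace ℂ K]
    (J : FunctionSpace H) (L : FunctionSpace K) : Prop :=
  LinearMap.range J.toFun ≤ LinearMap.range L.toFun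

/-- The action of `P(x, d/dx) = ∑_{m=0}^M p_m(x) (d/dx)^m`. -/
def diffOp {M : ℕ} (p : Fin (M + 1) → ℝ → ℂ) (F : ℝ → ℂ) (x : ℝ) : ℂ :=
  ∑ m : Fin (M + 1), p m x * iteratedDeriv (m : ℕ) F x

/-- The coefficient functions of `P(λ; x, d/dx) = P(x, d/dx) - λ I`. -/
def subScalar {M : ℕ} (p : Fin (M + 1) → ℝ → ℂ) (lam : ℂ) : Fin (M + 1) → ℝ → ℂ :=
  fun m x => if m = 0 then p m x - lam else p m x

theorem diffOp_subScalar {M : ℕ} (p : Fin (M + 1) → ℝ → ℂ) (lam : ℂ) (F : ℝ → ℂ) (x : ℝ) :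
    diffOp (subScalar p lam) F x = diffOp p F x - lam * F x := by
  simp only [diffOp, subScalar, Fin.sum_univ_succ]
  simp [Fin.succ_ne_zero]
  ring

theorem diffOp_add {M : ℕ} (p : Fin (M + 1) → ℝ → ℂ) {F G : ℝ → ℂ}
    (hF : ContDiff ℝ M F) (hG : ContDiff ℝ M G) (x : ℝ) :
    diffOp p (F + G) x = diffOp p F x + diffOp p G x := by
  simp only [diffOp, ← Finset.sum_add_distrib]
  refine Finset.sum_congr rfl fun m _ => ?_
  have hm : ((m : ℕ) : WithTop ℕ∞) ≤ (M : WithTop ℕ∞) := by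
    exact_mod_cast Nat.lt_succ_iff.mp m.2
  rw [iteratedDeriv_add (hF.of_le hm).contDiffAt (hG.of_le hm).contDiffAt, mul_add]

theorem diffOp_smul {M : ℕ} (p : Fin (M + 1) → ℝ → ℂ) (c : ℂ) (F : ℝ → ℂ) (x : ℝ) :
    diffOp p (c • F) x = c * diffOp p F x := by
  simp only [diffOp, Finset.mul_sum]
  refine Finset.sum_congr rfl fun m _ => ?_
  rw [iteratedDeriv_const_smul_field, smul_eq_mul]
  ring

theorem diffOp_zero {M : ℕ} (p : Fin (M + 1) → ℝ → ℂ) (x : ℝ) :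
    diffOp p (0 : ℝ → ℂ) x = 0 := by
  simpa using diffOp_smul p 0 0 x

section Operators

variable {H K : Type*} [NormedAddCommGroup H] [InnerProductSpace ℂ H]
  [NormedAddCommGroup K] [InnerProductSpace ℂ K]

/-- The graph of the action of `P(x, d/dx)` from `H` to `K` with domain
`{f ∈ C^M(ℝ) ∩ H | P(x, d/dx) f ∈ K}`. -/
def diffOpGraph (J : FunctionSpace H) (L : FunctionSpace K) {M : ℕ}
    (p : Fin (M + 1) → ℝ → ℂ) : Submodule ℂ (H × K) where
  carrier := {z | ∃ F : ℝ → ℂ, ContDiff ℝ M F ∧ J.Rep z.1 F ∧ L.Rep z.2 (diffOp p F)}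
  zero_mem' := by
    refine ⟨0, contDiff_const, ?_, ?_⟩
    · rw [FunctionSpace.Rep, Prod.fst_zero, map_zero]
      exact AEEqFun.coeFn_const (μ := (volume : Measure ℝ)) ℝ (0 : ℂ)
    · have h : diffOp p (0 : ℝ → ℂ) = fun _ => (0 : ℂ) := funext (diffOp_zero p)
      rw [h, FunctionSpace.Rep, Prod.snd_zero, map_zero]
      exact AEEqFun.coeFn_const (μ := (volume : Measure ℝ)) ℝ (0 : ℂ)
  add_mem' := by
    rintro a b ⟨F, hF, hF1, hF2⟩ ⟨G, hG, hG1, hG2⟩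
    refine ⟨F + G, hF.add hG, ?_, ?_⟩
    · simp only [FunctionSpace.Rep, Prod.fst_add, map_add] at *
      exact (AEEqFun.coeFn_add _ _).trans (hF1.add hG1)
    · simp only [FunctionSpace.Rep, Prod.snd_add, map_add] at *
      have h : diffOp p (F + G) = diffOp p F + diffOp p G := funext (diffOp_add p hF hG)
      rw [h]
      exact (AEEqFun.coeFn_add _ _).trans (hF2.add hG2)
  smul_mem' := by
    rintro c a ⟨F, hF, hF1, hF2⟩
    refine ⟨c • F, contDiff_const.smul hF, ?_, ?_⟩
    · simp only [FunctionSpace.Rep, Prod.smul_fst, map_smul] at *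
      exact (AEEqFun.coeFn_smul _ _).trans (hF1.const_smul c)
    · simp only [FunctionSpace.Rep, Prod.smul_snd, map_smul] at *
      have h : diffOp p (c • F) = c • diffOp p F := funext (diffOp_smul p c F)
      rw [h]
      exact (AEEqFun.coeFn_smul _ _).trans (hF2.const_smul c)

/-- The graph is that of a (single-valued) operator. -/
theorem diffOpGraph_singleValued (J : FunctionSpace H) (L : FunctionSpace K) {M : ℕ}
    (p : Fin (M + 1) → ℝ → ℂ) (z : H × K) (hz : z ∈ diffOpGraph J L p) (h0 : z.1 = 0) :
    z.2 = 0 := by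
  obtain ⟨F, hF, hF1, hF2⟩ := hz
  have hzero : ∀ᵐ x : ℝ, ((0 : ℝ →ₘ[volume] ℂ) : ℝ → ℂ) x = 0 :=
    AEEqFun.coeFn_const (μ := (volume : Measure ℝ)) ℝ (0 : ℂ)
  have hF0 : F = 0 := by
    refine (Continuous.ae_eq_iff_eq (volume : Measure ℝ) hF.continuous continuous_const).mp ?_
    rw [FunctionSpace.Rep, h0, map_zero] at hF1
    filter_upwards [hF1, hzero] with x hx hx0
    rw [← hx, hx0]; rfl
  subst hF0
  apply L.injective
  rw [map_zero]
  refine AEEqFun.ext ?_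
  filter_upwards [hF2, hzero] with x hx hx0
  rw [hx, hx0, diffOp_zero]

/-- The operator from `H` to `K` given by the action of `P(x, d/dx)` with domain
`{f ∈ C^M(ℝ) ∩ H | P(x, d/dx) f ∈ K}`. -/
def diffOperator (J : FunctionSpace H) (L : FunctionSpace K) {M : ℕ}
    (p : Fin (M + 1) → ℝ → ℂ) : H →ₗ.[ℂ] K :=
  (diffOpGraph J L p).toLinearPMap

theorem mem_graph_diffOperator (J : FunctionSpace H) (L : FunctionSpace K) {M : ℕ}
    (p : Fin (M + 1) → ℝ → ℂ) (f : H) (g : K) :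
    (f, g) ∈ (diffOperator J L p).graph ↔
      ∃ F : ℝ → ℂ, ContDiff ℝ M F ∧ J.Rep f F ∧ L.Rep g (diffOp p F) := by
  rw [diffOperator, Submodule.toLinearPMap_graph_eq _ (diffOpGraph_singleValued J L p)]
  rfl

/-- The operator `Ã_{P,H}`. -/
def opATilde (J : FunctionSpace H) {M : ℕ} (p : Fin (M + 1) → ℝ → ℂ) : H →ₗ.[ℂ] H :=
  diffOperator J J p

/-- The operator `A_{P,H}`: the closure of `Ã_{P,H}` in the graph norm. -/
def opA (J : FunctionSpace H) {M : ℕ} (p : Fin (M + 1) → ℝ → ℂ) : H →ₗ.[ℂ] H :=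
  (opATilde J p).closure

/-- The operator `B̃_{P,λ,H,K}`. -/
def opBTilde (J : FunctionSpace H) (L : FunctionSpace K) {M : ℕ}
    (p : Fin (M + 1) → ℝ → ℂ) (lam : ℂ) : H →ₗ.[ℂ] K :=
  diffOperator J L (subScalar p lam)

/-- The operator `B_{P,λ,H,K}`: the closure of `B̃_{P,λ,H,K}` in the graph norm. -/
def opB (J : FunctionSpace H) (L : FunctionSpace K) {M : ℕ}
    (p : Fin (M + 1) → ℝ → ℂ) (lam : ℂ) : H →ₗ.[ℂ] K :=
  (opBTilde J L p lam).closure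

/-- Condition C1. -/
def CondC1 (J : FunctionSpace H) (L : FunctionSpace K) {M : ℕ}
    (p : Fin (M + 1) → ℝ → ℂ) (lam : ℂ) (e : HilbertBasis ℕ ℂ H) : Prop :=
  ∀ n, e n ∈ (opBTilde J L p lam).domain

/-- The matrix `b_m^n = ⟨B e_n, e'_m⟩_K`, as `matB … m n`. Mathlib's inner product is
conjugate-linear in its first argument, so that the arguments appear exchanged. -/
def matB (J : FunctionSpace H) (L : FunctionSpace K) {M : ℕ}
    (p : Fin (M + 1) → ℝ → ℂ) (lam : ℂ) (e : HilbertBasis ℕ ℂ H) (e' : HilbertBasis ℕ ℂ K)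
    (h1 : CondC1 J L p lam e) (m n : ℕ) : ℂ :=
  inner ℂ (e' m) (opB J L p lam ⟨e n, (opBTilde J L p lam).le_closure.1 (h1 n)⟩)

/-- Condition C2: the matrix is band-diagonal. -/
def CondC2 (b : ℕ → ℕ → ℂ) : Prop :=
  ∃ l₀ : ℤ, ∀ m n : ℕ, l₀ < |(n : ℤ) - (m : ℤ)| → b m n = 0

/-- Condition C2⁺. -/
def CondC2plus (L : FunctionSpace K) (M : ℕ) : Prop :=
  ∃ v : ℝ → ℝ, ContDiff ℝ M v ∧ (∀ x, 0 < v x) ∧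
    ∀ f g : K, Integrable (fun x : ℝ => L.toFun f x * conj (L.toFun g x) * (v x : ℂ)) ∧
      inner ℂ g f = ∫ x : ℝ, L.toFun f x * conj (L.toFun g x) * (v x : ℂ)

/-- Condition C2.1: `|b_m^n| / n^M` is bounded over all `m` and all `n ≥ 1`. -/
def CondC21 (M : ℕ) (b : ℕ → ℕ → ℂ) : Prop :=
  ∃ C : ℝ, ∀ m n : ℕ, 1 ≤ n → ‖b m n‖ / (n : ℝ) ^ M ≤ C

/-- Condition C2.2. The lower limit is taken in the extended reals. -/
def CondC22 (L : FunctionSpace K) (M : ℕ) (e' : HilbertBasis ℕ ℂ K) : Prop :=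
  ∃ E : ℕ → ℝ → ℂ, (∀ n, ContDiff ℝ M (E n) ∧ L.Rep (e' n) (E n)) ∧
    ∃ n₁ n₀ : ℝ → ℂ, ContDiff ℝ (M - 1 : ℕ) n₁ ∧ ContDiff ℝ (M - 1 : ℕ) n₀ ∧
      ∃ μ : ℕ → ℝ, (∀ n x, n₁ x * deriv (E n) x + n₀ x * E n x = (μ n : ℂ) * E n x) ∧
        0 < liminf (fun n : ℕ => ((|μ n| / (n : ℝ) : ℝ) : EReal)) atTop

/-- Condition C2.3, on the continuous representatives of the basis functions. -/
def CondC23 (L : FunctionSpace K) (e' : HilbertBasis ℕ ℂ K) : Prop :=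
  ∃ a : ℝ → ℝ, Continuous a ∧
    ∀ n, ∃ F : ℝ → ℂ, Continuous F ∧ L.Rep (e' n) F ∧ ∀ x, ‖F x‖ ≤ a x

/-- Condition C3. -/
def CondC3 (J : FunctionSpace H) (L : FunctionSpace K) {M : ℕ}
    (p : Fin (M + 1) → ℝ → ℂ) (lam : ℂ) (e' : HilbertBasis ℕ ℂ K) : Prop :=
  ∃ C : K →ₗ.[ℂ] H, Dense (C.domain : Set K) ∧
    ∀ m, ∃ hm : e' m ∈ C.domain, ∀ f : (opBTilde J L p lam).domain,
      inner ℂ (e' m) (opB J L p lam ⟨f, (opBTilde J L p lam).le_closure.1 f.2⟩) =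
        inner ℂ (C ⟨e' m, hm⟩) (f : H)

/-- The space `V` of all sequences with `∑_n b_m^n f_n = 0` for every `m`. -/
def solutionSpace (b : ℕ → ℕ → ℂ) : Set (ℕ → ℂ) :=
  {s | ∀ m, HasSum (fun n => b m n * s n) 0}

end Operators

end

open scoped ContDiff

/-! The implications run 1 → 2 → 3 → 4 → 1; all but 3 → 4 are soft. The closed graph theorem makes
the inclusion of `H` in `K` continuous, and the weight of C2⁺ makes pairing with a test function a
bounded functional on `K`. Hence every pair in the closure of the graph satisfies the equation
weakly (`integral_mul_eq_of_mem_closure`), which gives closability. C3 makes the coefficients of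
`Bf` continuous in `f`, which gives 2 → 3.

For 3 → 4, let `f_N` be the partial sums of `f` and `φ` a test function. The numbers `G N = ∫ (B
f_N) φ = ∫ f_N (Pᵗφ)` converge to `∫ f (Pᵗφ)`, and this limit must be shown to vanish. In the basis
of `K`, the band structure and membership in `V` leave in `G N` only a bounded window of indices
near `N`. There the matrix entries are `O(N^M)`, while transposing the first-order eigenvalue
equation `M - 1` times shows that the coefficients of `φ` are `O(N^(1-M))` times an `ℓ²` sequence.
So `|G N|` is at most `N` times a summable sequence, and a nonzero limit would make the harmonic
series converge (`eq_zero_of_band`). Thus `f` is a distributional solution, and since the leading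
coefficient has no zeros it is classical (`exists_contDiff_ae_eq_of_weak`). -/

/-! ### Integration by parts against compactly supported functions -/

theorem integral_deriv_mul_eq_neg {u φ : ℝ → ℂ} (hu : ContDiff ℝ 1 u) (hφ : ContDiff ℝ 1 φ)
    (hc : HasCompactSupport φ) : ∫ x, deriv u x * φ x = -∫ x, u x * deriv φ x := by
  have hu' : Continuous (deriv u) := hu.continuous_deriv le_rfl
  have hφ' : Continuous (deriv φ) := hφ.continuous_deriv le_rfl
  have h := integral_mul_deriv_eq_deriv_mul_of_integrable (u := u) (v := φ) (u' := deriv u)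
    (v' := deriv φ) (fun x _ => (hu.differentiable one_ne_zero x).hasDerivAt)
    (fun x _ => (hφ.differentiable one_ne_zero x).hasDerivAt)
    ((hu.continuous.mul hφ').integrable_of_hasCompactSupport hc.deriv.mul_left)
    ((hu'.mul hφ.continuous).integrable_of_hasCompactSupport hc.mul_left)
    ((hu.continuous.mul hφ.continuous).integrable_of_hasCompactSupport hc.mul_left)
  rw [h, neg_neg]

theorem HasCompactSupport.iteratedDeriv_real {φ : ℝ → ℂ} (hc : HasCompactSupport φ) (m : ℕ) :
    HasCompactSupport (iteratedDeriv m φ) := by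
  induction m with
  | zero => simpa using hc
  | succ k ih => rw [iteratedDeriv_succ]; exact ih.deriv

theorem integral_iteratedDeriv_mul_eq (m : ℕ) {u φ : ℝ → ℂ} (hu : ContDiff ℝ m u)
    (hφ : ContDiff ℝ m φ) (hc : HasCompactSupport φ) :
    ∫ x, iteratedDeriv m u x * φ x = (-1) ^ m * ∫ x, u x * iteratedDeriv m φ x := by
  induction m generalizing u with
  | zero => simp
  | succ k ih =>
    have hu1 : ContDiff ℝ k (deriv u) := by
      have : ContDiff ℝ ((k : WithTop ℕ∞) + 1) u := by exact_mod_cast hu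
      exact (contDiff_succ_iff_deriv.mp this).2.2
    have hk : ContDiff ℝ k φ := hφ.of_le (by exact_mod_cast Nat.le_succ k)
    have hφ1 : ContDiff ℝ 1 (iteratedDeriv k φ) := by
      rw [iteratedDeriv_eq_iterate]
      exact ContDiff.iterate_deriv' 1 k (by rw [add_comm]; exact_mod_cast hφ)
    rw [iteratedDeriv_succ', ih hu1 hk, integral_deriv_mul_eq_neg
      (hu.of_le (by exact_mod_cast Nat.succ_le_succ (Nat.zero_le k))) hφ1
      (hc.iteratedDeriv_real k), iteratedDeriv_succ, pow_succ]
    ring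

/-- Fubini on the half-plane `t ≤ x`: integrating in `x` first leaves `∫_t^∞ φ' = -φ t`. No
differentiability of the primitive is needed. -/
theorem integral_primitive_mul_deriv_of_integrable {g φ : ℝ → ℂ} (hg : Integrable g)
    (hφ : ContDiff ℝ 1 φ) (hc : HasCompactSupport φ) :
    ∫ x, (∫ t in Set.Iic x, g t) * deriv φ x = -∫ x, g x * φ x := by
  have hφ' : Integrable (deriv φ) :=
    (hφ.continuous_deriv le_rfl).integrable_of_hasCompactSupport hc.deriv
  have hint : Integrable (fun z : ℝ × ℝ =>
      ({z : ℝ × ℝ | z.2 ≤ z.1}).indicator (fun z => g z.2 * deriv φ z.1) z)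
      (volume.prod volume) := by
    refine Integrable.indicator ?_ (measurableSet_le measurable_snd measurable_fst)
    exact (hφ'.mul_prod hg).congr (ae_of_all _ fun z => mul_comm _ _)
  have hswap := integral_integral_swap (f := fun x t : ℝ =>
    ({z : ℝ × ℝ | z.2 ≤ z.1}).indicator (fun z => g z.2 * deriv φ z.1) (x, t)) hint
  have h1 : ∀ x : ℝ, ∫ t, ({z : ℝ × ℝ | z.2 ≤ z.1}).indicator
      (fun z => g z.2 * deriv φ z.1) (x, t) = (∫ t in Set.Iic x, g t) * deriv φ x := by
    intro x
    rw [← integral_mul_const, ← integral_indicator measurableSet_Iic]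
    rfl
  have h2 : ∀ t : ℝ, ∫ x, ({z : ℝ × ℝ | z.2 ≤ z.1}).indicator
      (fun z => g z.2 * deriv φ z.1) (x, t) = -(g t * φ t) := by
    intro t
    have h3 : ∫ x in Set.Ioi t, deriv φ x = -φ t := hc.integral_Ioi_deriv_eq hφ t
    rw [← mul_neg, ← h3, ← integral_Ici_eq_integral_Ioi, ← integral_const_mul,
      ← integral_indicator measurableSet_Ici]
    rfl
  simp only [h1, h2] at hswap
  rw [hswap, integral_neg]

theorem HasCompactSupport.exists_forall_notMem_tsupport {φ : ℝ → ℂ} (hc : HasCompactSupport φ) :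
    ∃ R : ℝ, 0 < R ∧ ∀ x, x ∉ Set.Ioo (-R) R → x ∉ tsupport φ := by
  obtain ⟨R, hR⟩ := hc.isCompact.isBounded.subset_ball (0 : ℝ)
  refine ⟨max R 1, by positivity, fun x hx h => hx ?_⟩
  have := hR h
  rw [Metric.mem_ball, dist_zero_right, Real.norm_eq_abs, abs_lt] at this
  exact ⟨by linarith [le_max_left R 1], lt_of_lt_of_le this.2 (le_max_left R 1)⟩

theorem HasCompactSupport.integral_deriv_eq_zero {φ : ℝ → ℂ} (hφ : ContDiff ℝ 1 φ)
    (hc : HasCompactSupport φ) : ∫ x, deriv φ x = 0 := by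
  have := integral_deriv_mul_eq_neg (u := fun _ => 1) contDiff_const hφ hc
  simpa using this

/-- Reduction to the integrable case: `φ` lives in `(-R, R)`, so `g` may be cut off there. Moving
the base point from `-R` to `0` changes the primitive by a constant, which is invisible because `∫
φ' = 0`. -/
theorem integral_primitive_mul_deriv {g φ : ℝ → ℂ} (hg : LocallyIntegrable g)
    (hφ : ContDiff ℝ 1 φ) (hc : HasCompactSupport φ) :
    ∫ x, (∫ t in (0 : ℝ)..x, g t) * deriv φ x = -∫ x, g x * φ x := by
  obtain ⟨R, hR0, hRt⟩ := hc.exists_forall_notMem_tsupport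
  have hR : ∀ x, x ∉ Set.Ioo (-R) R → φ x = 0 := fun x hx =>
    image_eq_zero_of_notMem_tsupport (hRt x hx)
  have hR' : ∀ x, x ∉ Set.Ioo (-R) R → deriv φ x = 0 := fun x hx =>
    by_contra fun h => hRt x hx (support_deriv_subset h)
  have hgi : Integrable ((Set.Ioc (-R) R).indicator g) :=
    ((hg.integrableOn_isCompact isCompact_Icc).mono_set Set.Ioc_subset_Icc_self).integrable_indicator
      measurableSet_Ioc
  have hii : ∀ a b : ℝ, IntervalIntegrable g volume a b := fun a b =>
    (hg.integrableOn_isCompact isCompact_uIcc).intervalIntegrable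
  have key := integral_primitive_mul_deriv_of_integrable hgi hφ hc
  have e1 : ∀ x, (∫ t in Set.Iic x, (Set.Ioc (-R) R).indicator g t) * deriv φ x =
      (∫ t in (0 : ℝ)..x, g t) * deriv φ x - (∫ t in (0 : ℝ)..(-R), g t) * deriv φ x := by
    intro x
    by_cases hx : x ∈ Set.Ioo (-R) R
    · rw [← sub_mul, intervalIntegral.integral_interval_sub_left (hii _ _) (hii _ _),
        intervalIntegral.integral_of_le hx.1.le, setIntegral_indicator measurableSet_Ioc]
      congr 3
      ext y
      simp only [Set.mem_inter_iff, Set.mem_Iic, Set.mem_Ioc]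
      exact ⟨fun h => ⟨h.2.1, h.1⟩, fun h => ⟨h.2, h.1, h.2.trans hx.2.le⟩⟩
    · simp [hR' x hx]
  have e2 : ∀ x, (Set.Ioc (-R) R).indicator g x * φ x = g x * φ x := by
    intro x
    by_cases hx : x ∈ Set.Ioo (-R) R
    · rw [Set.indicator_of_mem (Set.Ioo_subset_Ioc_self hx)]
    · simp [hR x hx]
  simp only [e1, e2] at key
  have hcont : Continuous fun x => ∫ t in (0 : ℝ)..x, g t :=
    intervalIntegral.continuous_primitive hii 0
  have hφ' : Continuous (deriv φ) := hφ.continuous_deriv le_rfl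
  have i1 : Integrable fun x => (∫ t in (0 : ℝ)..x, g t) * deriv φ x :=
    (hcont.mul hφ').integrable_of_hasCompactSupport hc.deriv.mul_left
  have i2 : Integrable fun x => (∫ t in (0 : ℝ)..(-R), g t) * deriv φ x :=
    (continuous_const.mul hφ').integrable_of_hasCompactSupport hc.deriv.mul_left
  rwa [integral_sub i1 i2, integral_const_mul, HasCompactSupport.integral_deriv_eq_zero hφ hc,
    mul_zero, sub_zero] at key

/-! ### Du Bois-Reymond lemma and removal of one derivative -/

theorem exists_contDiff_integral_eq_one :
    ∃ θ : ℝ → ℂ, ContDiff ℝ ∞ θ ∧ HasCompactSupport θ ∧ ∫ x, θ x = 1 := by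
  let b : ContDiffBump (0 : ℝ) := ⟨1, 2, one_pos, one_lt_two⟩
  refine ⟨fun x => ((b.normed volume x : ℝ) : ℂ),
    Complex.ofRealCLM.contDiff.comp b.contDiff_normed, ?_, ?_⟩
  · exact b.hasCompactSupport_normed.comp_left (g := fun y : ℝ => (y : ℂ)) Complex.ofReal_zero
  · rw [integral_complex_ofReal, b.integral_normed, Complex.ofReal_one]

theorem exists_contDiff_deriv_eq {η : ℝ → ℂ} (hη : ContDiff ℝ ∞ η) (hc : HasCompactSupport η)
    (h0 : ∫ x, η x = 0) :
    ∃ φ : ℝ → ℂ, ContDiff ℝ ∞ φ ∧ HasCompactSupport φ ∧ deriv φ = η := by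
  obtain ⟨R, hR0, hRt⟩ := hc.exists_forall_notMem_tsupport
  have hR : ∀ x, x ∉ Set.Ioo (-R) R → η x = 0 := fun x hx =>
    image_eq_zero_of_notMem_tsupport (hRt x hx)
  have hder : ∀ x, HasDerivAt (fun x => ∫ t in (-R)..x, η t) (η x) x := fun x =>
    intervalIntegral.integral_hasDerivAt_right (hη.continuous.intervalIntegrable _ _)
      (hη.continuous.stronglyMeasurableAtFilter _ _) hη.continuous.continuousAt
  have hd : deriv (fun x => ∫ t in (-R)..x, η t) = η := funext fun x => (hder x).deriv
  refine ⟨fun x => ∫ t in (-R)..x, η t, ?_, ?_, hd⟩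
  · rw [contDiff_infty_iff_deriv, hd]
    exact ⟨fun x => (hder x).differentiableAt, hη⟩
  · refine HasCompactSupport.intro (isCompact_Icc (a := -R) (b := R)) fun x hx => ?_
    rw [Set.mem_Icc, not_and_or, not_le, not_le] at hx
    rcases hx with hx | hx
    · refine intervalIntegral.integral_zero_ae (ae_of_all _ fun t ht => hR t fun h => ?_)
      rw [Set.uIoc_of_ge hx.le] at ht
      exact absurd h.1 (not_lt.mpr ht.2)
    · rw [intervalIntegral.integral_of_le (by linarith), ← h0]
      refine setIntegral_eq_integral_of_forall_compl_eq_zero fun t ht => hR t fun h => ht ?_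
      exact ⟨h.1, h.2.le.trans hx.le⟩

/-- With `∫ θ = 1`, the function `φ - (∫ φ) θ` has integral zero, hence is the derivative of a test
function and is killed by `Λ`. -/
theorem exists_integral_eq_of_forall_deriv {Λ : (ℝ → ℂ) → ℂ}
    (hadd : ∀ φ ψ : ℝ → ℂ, ContDiff ℝ ∞ φ → HasCompactSupport φ → ContDiff ℝ ∞ ψ →
      HasCompactSupport ψ → ∀ c : ℂ, Λ (φ + c • ψ) = Λ φ + c * Λ ψ)
    (hder : ∀ φ : ℝ → ℂ, ContDiff ℝ ∞ φ → HasCompactSupport φ → Λ (deriv φ) = 0) :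
    ∃ c : ℂ, ∀ φ : ℝ → ℂ, ContDiff ℝ ∞ φ → HasCompactSupport φ → Λ φ = c * ∫ x, φ x := by
  obtain ⟨θ, hθ, hθc, hθ1⟩ := exists_contDiff_integral_eq_one
  refine ⟨Λ θ, fun φ hφ hφc => ?_⟩
  have hiφ : Integrable φ := hφ.continuous.integrable_of_hasCompactSupport hφc
  have hiθ : Integrable θ := hθ.continuous.integrable_of_hasCompactSupport hθc
  have hs : ContDiff ℝ ∞ (φ + (-∫ x, φ x) • θ) := hφ.add (contDiff_const.smul hθ)
  have hsc : HasCompactSupport (φ + (-∫ x, φ x) • θ) := hφc.add (hθc.smul_left (f := fun _ => _))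
  obtain ⟨χ, hχ, hχc, hχd⟩ := exists_contDiff_deriv_eq hs hsc (by
    simp only [Pi.add_apply, Pi.smul_apply, smul_eq_mul]
    rw [integral_add hiφ (hiθ.const_mul _), integral_const_mul, hθ1]; ring)
  have h := hder χ hχ hχc
  rw [hχd, hadd φ θ hφ hφc hθ hθc] at h
  linear_combination h

theorem MeasureTheory.LocallyIntegrable.integrable_mul_of_hasCompactSupport {g φ : ℝ → ℂ}
    (hg : LocallyIntegrable g) (hφ : Continuous φ) (hc : HasCompactSupport φ) :
    Integrable fun x => g x * φ x :=
  hg.integrable_smul_right_of_hasCompactSupport hφ hc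

theorem ContDiff.iteratedDeriv_infty {φ : ℝ → ℂ} (hφ : ContDiff ℝ ∞ φ) (m : ℕ) :
    ContDiff ℝ ∞ (iteratedDeriv m φ) := by
  rw [iteratedDeriv_eq_iterate]
  exact hφ.iterate_deriv m

/-- Lowers the order of a weak equation by one. By the hypothesis and an integration by parts, the
difference of the two sides with `c = 0` vanishes on derivatives of test functions, so it is a
constant times the integral. -/
theorem exists_integral_sum_iteratedDeriv_eq_primitive {M : ℕ} {g : ℕ → ℝ → ℂ} {A : ℝ → ℂ}
    (hg : ∀ j ≤ M + 1, LocallyIntegrable (g j)) (hA : LocallyIntegrable A)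
    (h : ∀ φ : ℝ → ℂ, ContDiff ℝ ∞ φ → HasCompactSupport φ →
      ∑ j ∈ Finset.range (M + 2), ∫ x, g j x * iteratedDeriv j φ x = ∫ x, A x * φ x) :
    ∃ c : ℂ, ∀ φ : ℝ → ℂ, ContDiff ℝ ∞ φ → HasCompactSupport φ →
      ∑ j ∈ Finset.range (M + 1), ∫ x, g (j + 1) x * iteratedDeriv j φ x =
        ∫ x, (c + ∫ t in (0 : ℝ)..x, (g 0 t - A t)) * φ x := by
  have hgA : LocallyIntegrable fun x => g 0 x - A x := (hg 0 (by omega)).sub hA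
  have hcont : Continuous fun x => ∫ t in (0 : ℝ)..x, (g 0 t - A t) :=
    intervalIntegral.continuous_primitive
      (fun a b => (hgA.integrableOn_isCompact isCompact_uIcc).intervalIntegrable) 0
  have hint : ∀ j ≤ M, ∀ φ : ℝ → ℂ, ContDiff ℝ ∞ φ → HasCompactSupport φ →
      Integrable fun x => g (j + 1) x * iteratedDeriv j φ x := fun j hj φ hφ hc =>
    (hg (j + 1) (by omega)).integrable_mul_of_hasCompactSupport
      (hφ.iteratedDeriv_infty j).continuous (hc.iteratedDeriv_real j)
  have hint2 : ∀ φ : ℝ → ℂ, ContDiff ℝ ∞ φ → HasCompactSupport φ →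
      Integrable fun x => (∫ t in (0 : ℝ)..x, (g 0 t - A t)) * φ x := fun φ hφ hc =>
    (hcont.mul hφ.continuous).integrable_of_hasCompactSupport hc.mul_left
  obtain ⟨c, hc⟩ := exists_integral_eq_of_forall_deriv (Λ := fun ψ =>
    (∑ j ∈ Finset.range (M + 1), ∫ x, g (j + 1) x * iteratedDeriv j ψ x) -
      ∫ x, (∫ t in (0 : ℝ)..x, (g 0 t - A t)) * ψ x) (by
    intro φ ψ hφ hφc hψ hψc c
    have e1 : ∀ j ∈ Finset.range (M + 1), ∫ x, g (j + 1) x * iteratedDeriv j (φ + c • ψ) x =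
        (∫ x, g (j + 1) x * iteratedDeriv j φ x) +
          c * ∫ x, g (j + 1) x * iteratedDeriv j ψ x := by
      intro j hj
      have hj' : j ≤ M := by simpa [Nat.lt_succ_iff] using hj
      rw [← integral_const_mul, ← integral_add (hint j hj' φ hφ hφc)
        ((hint j hj' ψ hψ hψc).const_mul c)]
      congr 1
      ext x
      have hle : ((j : ℕ) : WithTop ℕ∞) ≤ (∞ : WithTop ℕ∞) := by exact_mod_cast le_top
      rw [iteratedDeriv_add (hφ.of_le hle).contDiffAt
        ((show ContDiff ℝ ∞ (c • ψ) from contDiff_const.smul hψ).of_le hle).contDiffAt,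
        iteratedDeriv_const_smul_field, smul_eq_mul]
      ring
    have e2 : ∫ x, (∫ t in (0 : ℝ)..x, (g 0 t - A t)) * (φ + c • ψ) x =
        (∫ x, (∫ t in (0 : ℝ)..x, (g 0 t - A t)) * φ x) +
          c * ∫ x, (∫ t in (0 : ℝ)..x, (g 0 t - A t)) * ψ x := by
      rw [← integral_const_mul, ← integral_add (hint2 φ hφ hφc) ((hint2 ψ hψ hψc).const_mul c)]
      congr 1
      ext x
      simp only [Pi.add_apply, Pi.smul_apply, smul_eq_mul]
      ring
    rw [Finset.sum_congr rfl e1, e2, Finset.sum_add_distrib, ← Finset.mul_sum]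
    ring) (by
    intro φ hφ hφc
    have h1 := h φ hφ hφc
    rw [Finset.sum_range_succ'] at h1
    simp only [iteratedDeriv_zero, iteratedDeriv_succ'] at h1
    have i1 : Integrable fun x => g 0 x * φ x :=
      (hg 0 (by omega)).integrable_mul_of_hasCompactSupport hφ.continuous hφc
    have i2 : Integrable fun x => A x * φ x :=
      hA.integrable_mul_of_hasCompactSupport hφ.continuous hφc
    rw [integral_primitive_mul_deriv hgA (hφ.of_le (by exact_mod_cast le_top)) hφc]
    simp only [sub_mul]
    rw [integral_sub i1 i2]
    linear_combination h1)
  refine ⟨c, fun φ hφ hφc => ?_⟩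
  have h1 := hc φ hφ hφc
  have i3 : Integrable φ := hφ.continuous.integrable_of_hasCompactSupport hφc
  simp only [add_mul]
  rw [integral_add (i3.const_mul c) (hint2 φ hφ hφc), integral_const_mul]
  linear_combination h1

theorem ae_eq_of_forall_integral_contDiff {g A : ℝ → ℂ} (hg : LocallyIntegrable g)
    (hA : LocallyIntegrable A)
    (h : ∀ φ : ℝ → ℂ, ContDiff ℝ ∞ φ → HasCompactSupport φ →
      ∫ x, g x * φ x = ∫ x, A x * φ x) : g =ᵐ[volume] A := by
  have h0 : ∀ᵐ x : ℝ, g x - A x = 0 := by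
    refine ae_eq_zero_of_integral_contDiff_smul_eq_zero (hg.sub hA) fun φ hφ hc => ?_
    have hc' : HasCompactSupport fun x => (φ x : ℂ) :=
      hc.comp_left (g := fun y : ℝ => (y : ℂ)) Complex.ofReal_zero
    have hφ' : ContDiff ℝ ∞ fun x => (φ x : ℂ) := Complex.ofRealCLM.contDiff.comp hφ
    have h1 := h _ hφ' hc'
    rw [← sub_eq_zero, ← integral_sub
      (hg.integrable_mul_of_hasCompactSupport hφ'.continuous hc')
      (hA.integrable_mul_of_hasCompactSupport hφ'.continuous hc')] at h1
    rw [← h1]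
    congr 1
    ext x
    simp only [Complex.real_smul]
    ring
  filter_upwards [h0] with x hx using sub_eq_zero.mp hx

/-! ### Regularity of distributional solutions -/

theorem contDiff_primitive {g : ℝ → ℂ} {n : ℕ} (hg : ContDiff ℝ n g) (a : ℝ) :
    ContDiff ℝ (n + 1 : ℕ) fun x => ∫ t in a..x, g t := by
  have hder : ∀ x, HasDerivAt (fun x => ∫ t in a..x, g t) (g x) x := fun x =>
    intervalIntegral.integral_hasDerivAt_right (hg.continuous.intervalIntegrable _ _)
      (hg.continuous.stronglyMeasurableAtFilter _ _) hg.continuous.continuousAt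
  have : ContDiff ℝ ((n : WithTop ℕ∞) + 1) fun x => ∫ t in a..x, g t := by
    rw [contDiff_succ_iff_deriv]
    refine ⟨fun x => (hder x).differentiableAt, by simp, ?_⟩
    rwa [show deriv (fun x => ∫ t in a..x, g t) = g from funext fun x => (hder x).deriv]
  exact_mod_cast this

/-- Removing the derivatives one at a time leaves `f q_M` equal to iterated primitives. The
hypothesis `hn` encodes the regularity of `f` known so far, capped at `n`. The shift `s` counts the
derivatives already removed: it rises by one as `M` falls by one, so the smoothness `j + s` of the
coefficients is consistent. -/
theorem exists_contDiff_ae_eq_mul_of_weak {n M : ℕ} {f : ℝ → ℂ} (hf : LocallyIntegrable f)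
    (hn : ∀ (s : ℕ) (q : ℝ → ℂ), ContDiff ℝ s q →
      ContDiff ℝ (min (s + 1) n : ℕ) fun x => ∫ t in (0 : ℝ)..x, f t * q t)
    {s : ℕ} {q : ℕ → ℝ → ℂ} (hq : ∀ j ≤ M, ContDiff ℝ (j + s : ℕ) (q j)) {A : ℝ → ℂ}
    (hA : ContDiff ℝ (min s n : ℕ) A)
    (h : ∀ φ : ℝ → ℂ, ContDiff ℝ ∞ φ → HasCompactSupport φ →
      ∑ j ∈ Finset.range (M + 1), ∫ x, f x * q j x * iteratedDeriv j φ x = ∫ x, A x * φ x) :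
    ∃ G : ℝ → ℂ, ContDiff ℝ (min (M + s) n : ℕ) G ∧ (fun x => f x * q M x) =ᵐ[volume] G := by
  induction M generalizing s q A with
  | zero =>
    refine ⟨A, by simpa using hA, ae_eq_of_forall_integral_contDiff
      (hf.mul_continuous (hq 0 le_rfl).continuous) hA.continuous.locallyIntegrable
      fun φ hφ hc => ?_⟩
    simpa using h φ hφ hc
  | succ M ih =>
    obtain ⟨c, hc⟩ := exists_integral_sum_iteratedDeriv_eq_primitive
      (g := fun j x => f x * q j x)
      (fun j hj => hf.mul_continuous (hq j hj).continuous) hA.continuous.locallyIntegrable h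
    have hA' : ContDiff ℝ (min (s + 1) n : ℕ)
        fun x => c + ∫ t in (0 : ℝ)..x, (f t * q 0 t - A t) := by
      have e : (fun x => c + ∫ t in (0 : ℝ)..x, (f t * q 0 t - A t)) =
          fun x => c + ((∫ t in (0 : ℝ)..x, f t * q 0 t) - ∫ t in (0 : ℝ)..x, A t) := by
        ext x
        rw [intervalIntegral.integral_sub
          (((hf.mul_continuous (hq 0 (by omega)).continuous).integrableOn_isCompact
            isCompact_uIcc).intervalIntegrable) (hA.continuous.intervalIntegrable _ _)]
      rw [e]
      refine contDiff_const.add ((hn s (q 0) (by simpa using hq 0 (by omega))).sub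
        ((contDiff_primitive hA 0).of_le ?_))
      exact_mod_cast (by omega : min (s + 1) n ≤ min s n + 1)
    obtain ⟨G, hG, hGe⟩ := ih (s := s + 1) (q := fun j => q (j + 1))
      (fun j hj => by
        have := hq (j + 1) (by omega)
        rwa [show j + 1 + s = j + (s + 1) by ring] at this) hA' hc
    exact ⟨G, by rwa [show M + 1 + s = M + (s + 1) by ring], hGe⟩

/-- Distributional solutions of a nonsingular linear differential equation are classical. -/
theorem exists_contDiff_ae_eq_of_weak {M : ℕ} {f : ℝ → ℂ}
    (hf : LocallyIntegrable f) {q : ℕ → ℝ → ℂ} (hq : ∀ j ≤ M, ContDiff ℝ j (q j))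
    (hqM : ∀ x, q M x ≠ 0)
    (h : ∀ φ : ℝ → ℂ, ContDiff ℝ ∞ φ → HasCompactSupport φ →
      ∑ j ∈ Finset.range (M + 1), ∫ x, f x * q j x * iteratedDeriv j φ x = 0) :
    ∃ F : ℝ → ℂ, ContDiff ℝ M F ∧ f =ᵐ[volume] F := by
  -- One bootstrap round: `f q_M` is of class `C^n`, and dividing by the nonvanishing `q_M` passes
  -- this to `f`.
  have key : ∀ n ≤ M, (∀ (s : ℕ) (q : ℝ → ℂ), ContDiff ℝ s q →
      ContDiff ℝ (min (s + 1) n : ℕ) fun x => ∫ t in (0 : ℝ)..x, f t * q t) →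
      ∃ F : ℝ → ℂ, ContDiff ℝ n F ∧ f =ᵐ[volume] F := by
    intro n hnM hn
    obtain ⟨G, hG, hGe⟩ := exists_contDiff_ae_eq_mul_of_weak hf hn (s := 0)
      (q := q) (by simpa using hq) (A := fun _ => 0) contDiff_const (fun φ hφ hc => by simpa using h φ hφ hc)
    rw [show min (M + 0) n = n by omega] at hG
    refine ⟨fun x => G x * (q M x)⁻¹,
      hG.mul (((hq M le_rfl).of_le (by exact_mod_cast hnM)).inv hqM), ?_⟩
    filter_upwards [hGe] with x hx
    rw [← hx, mul_inv_cancel_right₀ (hqM x)]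
  have main : ∀ n ≤ M, ∃ F : ℝ → ℂ, ContDiff ℝ n F ∧ f =ᵐ[volume] F := by
    intro n
    induction n with
    | zero =>
      -- At the start `f` is only locally integrable, but its primitives against continuous
      -- functions are continuous.
      refine fun h0 => key 0 h0 fun s q hq => ?_
      rw [Nat.min_zero, Nat.cast_zero, contDiff_zero]
      exact intervalIntegral.continuous_primitive (fun a b =>
        ((hf.mul_continuous hq.continuous).integrableOn_isCompact
          isCompact_uIcc).intervalIntegrable) 0
    | succ k ih =>
      refine fun hk => key (k + 1) hk fun s q hq => ?_
      obtain ⟨F, hF, hFe⟩ := ih (by omega)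
      have e : (fun x => ∫ t in (0 : ℝ)..x, f t * q t) =
          fun x => ∫ t in (0 : ℝ)..x, F t * q t := by
        ext x
        refine intervalIntegral.integral_congr_ae ?_
        filter_upwards [hFe] with t ht _
        rw [ht]
      rw [e]
      have h1 : ContDiff ℝ (min s k : ℕ) fun t => F t * q t :=
        (hF.of_le (by exact_mod_cast min_le_right s k)).mul
          (hq.of_le (by exact_mod_cast min_le_left s k))
      exact (contDiff_primitive h1 0).of_le
        (by exact_mod_cast (by omega : min (s + 1) (k + 1) ≤ min s k + 1))
  exact main M le_rfl

/-! ### The formal transpose -/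

/-- The coefficients of the formal transpose of `∑ p_m (d/dx)^m`. -/
noncomputable def transposeCoeff {M : ℕ} (p : Fin (M + 1) → ℝ → ℂ) (j : ℕ) (x : ℝ) : ℂ :=
  ∑ m : Fin (M + 1), (-1) ^ (m : ℕ) * ((m : ℕ).choose j : ℂ) * iteratedDeriv ((m : ℕ) - j) (p m) x

theorem contDiff_transposeCoeff {M : ℕ} {p : Fin (M + 1) → ℝ → ℂ} (hp : ∀ m, ContDiff ℝ M (p m))
    {j : ℕ} (hj : j ≤ M) : ContDiff ℝ j (transposeCoeff p j) := by
  refine ContDiff.sum fun m _ => contDiff_const.mul ?_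
  rw [iteratedDeriv_eq_iterate]
  refine ContDiff.iterate_deriv' j _ ((hp m).of_le ?_)
  have := m.2
  exact_mod_cast (by omega : j + ((m : ℕ) - j) ≤ M)

theorem transposeCoeff_last {M : ℕ} (p : Fin (M + 1) → ℝ → ℂ) (x : ℝ) :
    transposeCoeff p M x = (-1) ^ M * p (Fin.last M) x := by
  rw [transposeCoeff, Finset.sum_eq_single (Fin.last M)]
  · simp
  · intro m _ hm
    rw [Nat.choose_eq_zero_of_lt (Fin.val_lt_last hm)]
    simp
  · simp

theorem integral_diffOp_mul {M : ℕ} {p : Fin (M + 1) → ℝ → ℂ} (hp : ∀ m, ContDiff ℝ M (p m))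
    {u φ : ℝ → ℂ} (hu : ContDiff ℝ M u) (hφ : ContDiff ℝ ∞ φ) (hc : HasCompactSupport φ) :
    ∫ x, diffOp p u x * φ x =
      ∑ j ∈ Finset.range (M + 1), ∫ x, u x * (transposeCoeff p j x * iteratedDeriv j φ x) := by
  have hle : ∀ m : Fin (M + 1), ((m : ℕ) : WithTop ℕ∞) ≤ M := fun m => by
    exact_mod_cast Nat.lt_succ_iff.mp m.2
  have hle' : ∀ m : ℕ, (m : WithTop ℕ∞) ≤ ∞ := fun m => by exact_mod_cast le_top
  have hprod : ∀ m : Fin (M + 1), ContDiff ℝ (m : ℕ) (φ * p m) := fun m =>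
    (hφ.of_le (hle' _)).mul ((hp m).of_le (hle m))
  have hprodc : ∀ m : Fin (M + 1), HasCompactSupport (φ * p m) := fun m => hc.mul_right
  have h1 : ∀ x, diffOp p u x * φ x =
      ∑ m : Fin (M + 1), iteratedDeriv (m : ℕ) u x * (φ * p m) x := by
    intro x
    rw [diffOp, Finset.sum_mul]
    exact Finset.sum_congr rfl fun m _ => by simp only [Pi.mul_apply]; ring
  have h2 : ∀ x, ∑ m : Fin (M + 1), (-1) ^ (m : ℕ) *
      (u x * iteratedDeriv (m : ℕ) (φ * p m) x) =
      ∑ j ∈ Finset.range (M + 1), u x * (transposeCoeff p j x * iteratedDeriv j φ x) := by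
    intro x
    have h3 : ∀ m : Fin (M + 1), iteratedDeriv (m : ℕ) (φ * p m) x =
        ∑ j ∈ Finset.range (M + 1),
          ((m : ℕ).choose j : ℂ) * iteratedDeriv j φ x * iteratedDeriv ((m : ℕ) - j) (p m) x := by
      intro m
      rw [iteratedDeriv_mul (hφ.of_le (hle' _)).contDiffAt ((hp m).of_le (hle m)).contDiffAt]
      -- The Leibniz sum is extended to a range independent of `m`, so that the sums can be
      -- exchanged; the binomial coefficients vanish for `j > m`.
      refine Finset.sum_subset (Finset.range_mono m.2) fun j _ hj => ?_
      rw [Nat.choose_eq_zero_of_lt (by simpa using hj)]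
      simp
    simp only [h3, transposeCoeff, Finset.mul_sum, Finset.sum_mul]
    rw [Finset.sum_comm]
    exact Finset.sum_congr rfl fun j _ => Finset.sum_congr rfl fun m _ => by ring
  have i1 : ∀ m ∈ (Finset.univ : Finset (Fin (M + 1))),
      Integrable fun x => iteratedDeriv (m : ℕ) u x * (φ * p m) x := fun m _ =>
    ((hu.continuous_iteratedDeriv _ (hle m)).mul
      (hprod m).continuous).integrable_of_hasCompactSupport (hprodc m).mul_left
  have i2 : ∀ m ∈ (Finset.univ : Finset (Fin (M + 1))),
      Integrable fun x => (-1) ^ (m : ℕ) * (u x * iteratedDeriv (m : ℕ) (φ * p m) x) := fun m _ =>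
    ((hu.continuous.mul ((hprod m).continuous_iteratedDeriv _
      le_rfl)).integrable_of_hasCompactSupport ((hprodc m).iteratedDeriv_real _).mul_left).const_mul _
  have i3 : ∀ j ∈ Finset.range (M + 1),
      Integrable fun x => u x * (transposeCoeff p j x * iteratedDeriv j φ x) := fun j hj =>
    (hu.continuous.mul ((contDiff_transposeCoeff hp
      (Nat.lt_succ_iff.mp (Finset.mem_range.mp hj))).continuous.mul
      (hφ.iteratedDeriv_infty j).continuous)).integrable_of_hasCompactSupport
      (hc.iteratedDeriv_real j).mul_left.mul_left
  simp only [h1]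
  rw [integral_finsetSum _ i1, ← integral_finsetSum _ i3]
  simp only [← h2]
  rw [integral_finsetSum _ i2]
  refine Finset.sum_congr rfl fun m _ => ?_
  rw [integral_iteratedDeriv_mul_eq _ (hu.of_le (hle m)) (hprod m) (hprodc m), integral_const_mul]

theorem contDiff_subScalar {M : ℕ} {p : Fin (M + 1) → ℝ → ℂ} (hp : ∀ m, ContDiff ℝ M (p m))
    (lam : ℂ) (m : Fin (M + 1)) : ContDiff ℝ M (subScalar p lam m) := by
  unfold subScalar
  by_cases hm : m = 0
  · simpa [hm] using (hp 0).sub contDiff_const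
  · simpa [hm] using hp m

/-! ### Inclusion, bounded functionals and closability -/

section FunctionSpaces

variable {H K : Type*} [NormedAddCommGroup H] [InnerProductSpace ℂ H]
  [NormedAddCommGroup K] [InnerProductSpace ℂ K]

theorem FunctionSpace.tendsto_unique (J : FunctionSpace H) (L : FunctionSpace K)
    {u : ℕ → H} {w : ℕ → K} {x : H} {y : K} (hu : Tendsto u atTop (𝓝 x))
    (hw : Tendsto w atTop (𝓝 y)) (huw : ∀ n, J.toFun (u n) = L.toFun (w n)) :
    J.toFun x = L.toFun y := by
  obtain ⟨φ, hφ, hφt⟩ := J.exists_subseq_tendsto_ae u x hu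
  obtain ⟨ψ, hψ, hψt⟩ := L.exists_subseq_tendsto_ae (w ∘ φ) y (hw.comp hφ.tendsto_atTop)
  refine AEEqFun.ext ?_
  filter_upwards [hφt, hψt] with t h1 h2
  refine tendsto_nhds_unique (h1.comp hψ.tendsto_atTop) (h2.congr fun k => ?_)
  simp only [Function.comp_apply, huw]

/-- Closed graph theorem: limits in the two spaces agree, since both are almost everywhere limits of
a common subsequence. -/
theorem FunctionSpace.Subset.exists_inclusion [CompleteSpace H] [CompleteSpace K]
    {J : FunctionSpace H} {L : FunctionSpace K}
    (h : J.Subset L) : ∃ ι : H →L[ℂ] K, ∀ f, L.toFun (ι f) = J.toFun f := by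
  have hex : ∀ f, ∃ g, L.toFun g = J.toFun f := fun f => h ⟨f, rfl⟩
  choose i hi using hex
  let ι₀ : H →ₗ[ℂ] K :=
    { toFun := i
      map_add' := fun a b => L.injective (by rw [map_add, hi, hi, hi, map_add])
      map_smul' := fun c a => L.injective (by
        rw [RingHom.id_apply, map_smul, hi, hi, map_smul]) }
  have hc : Continuous ι₀ := ι₀.continuous_of_seq_closed_graph fun u x y hu hy =>
    L.injective ((J.tendsto_unique L hu hy fun n => (hi (u n)).symm).symm.trans (hi x).symm)
  exact ⟨⟨ι₀, hc⟩, hi⟩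

theorem CondC2plus.norm_mul_le {L : FunctionSpace K} {M : ℕ} (h : CondC2plus L M) :
    ∃ v : ℝ → ℝ, Continuous v ∧ (∀ x, 0 < v x) ∧ ∀ f : K,
      Integrable (fun x : ℝ => ‖L.toFun f x‖ ^ 2 * v x) ∧
        ∫ x : ℝ, ‖L.toFun f x‖ ^ 2 * v x = ‖f‖ ^ 2 := by
  obtain ⟨v, hv, hv0, hL⟩ := h
  refine ⟨v, hv.continuous, hv0, fun f => ?_⟩
  obtain ⟨h1, h2⟩ := hL f f
  have e : ∀ x, L.toFun f x * conj (L.toFun f x) * (v x : ℂ) =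
      ((‖L.toFun f x‖ ^ 2 * v x : ℝ) : ℂ) := fun x => by
    rw [Complex.mul_conj']; push_cast; ring
  simp only [e] at h1 h2
  refine ⟨?_, ?_⟩
  · exact h1.re.congr (ae_of_all _ fun x => Complex.ofReal_re _)
  · rw [integral_complex_ofReal, inner_self_eq_norm_sq_to_K] at h2
    exact Complex.ofReal_injective (by rw [← h2]; simp)

/-- From `2|f| ≤ |f|² v + 1/v`, with `1/v` continuous. -/
theorem CondC2plus.locallyIntegrable {L : FunctionSpace K} {M : ℕ} (h : CondC2plus L M) (f : K) :
    LocallyIntegrable (L.toFun f) := by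
  obtain ⟨v, hv, hv0, hL⟩ := h.norm_mul_le
  have hcont : Continuous fun x => (v x)⁻¹ := hv.inv₀ fun x => (hv0 x).ne'
  refine ((hL f).1.locallyIntegrable.add hcont.locallyIntegrable).mono
    (L.toFun f).aestronglyMeasurable (ae_of_all _ fun x => ?_)
  have h1 : 0 < v x := hv0 x
  rw [Pi.add_apply, Real.norm_of_nonneg (by positivity)]
  have h2 : v x * (v x)⁻¹ = 1 := mul_inv_cancel₀ h1.ne'
  have h3 : 0 < (v x)⁻¹ := inv_pos.mpr h1
  have h4 : 0 ≤ (v x)⁻¹ * (‖L.toFun f x‖ * v x - 1) ^ 2 := by positivity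
  have h5 : (v x)⁻¹ * (‖L.toFun f x‖ * v x - 1) ^ 2 =
      ‖L.toFun f x‖ ^ 2 * v x - 2 * ‖L.toFun f x‖ + (v x)⁻¹ := by
    field_simp
    ring
  nlinarith [norm_nonneg (L.toFun f x)]

/-- Boundedness on the unit ball comes from `|fχ| ≤ |f|² v + |χ|²/v`, whose last term is continuous
with compact support. -/
theorem CondC2plus.exists_integral_functional {L : FunctionSpace K} {M : ℕ} (h : CondC2plus L M)
    {χ : ℝ → ℂ} (hχ : Continuous χ) (hc : HasCompactSupport χ) :
    ∃ Φ : K →L[ℂ] ℂ, ∀ f, Φ f = ∫ x, L.toFun f x * χ x := by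
  have hint : ∀ f : K, Integrable fun x => L.toFun f x * χ x := fun f =>
    (h.locallyIntegrable f).integrable_mul_of_hasCompactSupport hχ hc
  obtain ⟨Φ₀, hΦ₀⟩ : ∃ Φ₀ : K →ₗ[ℂ] ℂ, ∀ f, Φ₀ f = ∫ x, L.toFun f x * χ x := ⟨
    { toFun := fun f => ∫ x, L.toFun f x * χ x
      map_add' := fun f g => by
        rw [← integral_add (hint f) (hint g)]
        refine integral_congr_ae ?_
        rw [map_add]
        filter_upwards [AEEqFun.coeFn_add (L.toFun f) (L.toFun g)] with x hx
        rw [hx, Pi.add_apply, add_mul]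
      map_smul' := fun c f => by
        rw [RingHom.id_apply, smul_eq_mul, ← integral_const_mul]
        refine integral_congr_ae ?_
        rw [map_smul]
        filter_upwards [AEEqFun.coeFn_smul c (L.toFun f)] with x hx
        rw [hx, Pi.smul_apply, smul_eq_mul, mul_assoc] }, fun f => rfl⟩
  obtain ⟨v, hv, hv0, hL⟩ := h.norm_mul_le
  have hχi : Integrable fun x => ‖χ x‖ ^ 2 * (v x)⁻¹ := by
    have hcont : Continuous fun x => ‖χ x‖ ^ 2 * (v x)⁻¹ :=
      (hχ.norm.pow 2).mul (hv.inv₀ fun x => (hv0 x).ne')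
    exact hcont.integrable_of_hasCompactSupport (HasCompactSupport.intro hc.isCompact fun x hx => by
      rw [image_eq_zero_of_notMem_tsupport hx, norm_zero, zero_pow two_ne_zero, zero_mul])
  refine ⟨Φ₀.mkContinuousOfExistsBound ⟨_, Φ₀.bound_of_ball_bound' one_pos
    (1 + ∫ x, ‖χ x‖ ^ 2 * (v x)⁻¹) fun f hf => ?_⟩, hΦ₀⟩
  rw [hΦ₀]
  have hf1 : ‖f‖ ≤ 1 := by simpa using hf
  have hb : ∀ x, ‖L.toFun f x * χ x‖ ≤ ‖L.toFun f x‖ ^ 2 * v x + ‖χ x‖ ^ 2 * (v x)⁻¹ := by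
    intro x
    have h1 : 0 < v x := hv0 x
    have h3 : 0 < (v x)⁻¹ := inv_pos.mpr h1
    have h4 : 0 ≤ (v x)⁻¹ * (‖L.toFun f x‖ * v x - ‖χ x‖) ^ 2 := by positivity
    have h5 : (v x)⁻¹ * (‖L.toFun f x‖ * v x - ‖χ x‖) ^ 2 =
        ‖L.toFun f x‖ ^ 2 * v x - 2 * (‖L.toFun f x‖ * ‖χ x‖) + ‖χ x‖ ^ 2 * (v x)⁻¹ := by
      field_simp
      ring
    rw [norm_mul]
    nlinarith [mul_nonneg (norm_nonneg (L.toFun f x)) (norm_nonneg (χ x))]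
  calc ‖∫ x, L.toFun f x * χ x‖ ≤ ∫ x, (‖L.toFun f x‖ ^ 2 * v x + ‖χ x‖ ^ 2 * (v x)⁻¹) :=
        norm_integral_le_of_norm_le ((hL f).1.add hχi) (ae_of_all _ hb)
    _ = ‖f‖ ^ 2 + ∫ x, ‖χ x‖ ^ 2 * (v x)⁻¹ := by rw [integral_add (hL f).1 hχi, (hL f).2]
    _ ≤ 1 + ∫ x, ‖χ x‖ ^ 2 * (v x)⁻¹ := by gcongr; exact pow_le_one₀ (norm_nonneg f) hf1

/-- Elements of the closure of the graph of a differential operator satisfy the equation in the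
sense of distributions. -/
theorem integral_mul_eq_of_mem_closure {J : FunctionSpace H} {L : FunctionSpace K} {M : ℕ}
    (h : CondC2plus L M) {ι : H →L[ℂ] K} (hι : ∀ f, L.toFun (ι f) = J.toFun f)
    {p : Fin (M + 1) → ℝ → ℂ} (hp : ∀ m, ContDiff ℝ M (p m)) {z : H × K}
    (hz : z ∈ (diffOpGraph J L p).topologicalClosure) {φ : ℝ → ℂ} (hφ : ContDiff ℝ ∞ φ)
    (hc : HasCompactSupport φ) :
    ∫ x, L.toFun z.2 x * φ x = ∑ j ∈ Finset.range (M + 1),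
      ∫ x, J.toFun z.1 x * (transposeCoeff p j x * iteratedDeriv j φ x) := by
  obtain ⟨Φ, hΦ⟩ := h.exists_integral_functional hφ.continuous hc
  have hex : ∀ j : ℕ, ∃ Ψ : K →L[ℂ] ℂ, j ∈ Finset.range (M + 1) → ∀ f, Ψ f =
      ∫ x, L.toFun f x * (transposeCoeff p j x * iteratedDeriv j φ x) := by
    intro j
    by_cases hj : j ∈ Finset.range (M + 1)
    · obtain ⟨Ψ, hΨ⟩ := h.exists_integral_functional
        ((contDiff_transposeCoeff hp (Nat.lt_succ_iff.mp (Finset.mem_range.mp hj))).continuous.mul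
          (hφ.iteratedDeriv_infty j).continuous) (hc.iteratedDeriv_real j).mul_left
      exact ⟨Ψ, fun _ => hΨ⟩
    · exact ⟨0, fun hj' => absurd hj' hj⟩
  choose Ψ hΨ using hex
  -- The weight is known only for `K`, so the pairing with the first component becomes continuous by
  -- passing through `ι`.
  have hclosed : IsClosed {z : H × K | Φ z.2 = ∑ j ∈ Finset.range (M + 1), Ψ j (ι z.1)} :=
    isClosed_eq (by fun_prop) (by fun_prop)
  have hsub : (diffOpGraph J L p : Set (H × K)) ⊆
      {z : H × K | Φ z.2 = ∑ j ∈ Finset.range (M + 1), Ψ j (ι z.1)} := by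
    rintro z ⟨F, hF, hF1, hF2⟩
    rw [Set.mem_ofPred_eq, hΦ, Finset.sum_congr rfl fun j hj => hΨ j hj _]
    have e1 : ∫ x, L.toFun z.2 x * φ x = ∫ x, diffOp p F x * φ x := by
      refine integral_congr_ae ?_
      filter_upwards [hF2] with x hx
      rw [hx]
    rw [e1, integral_diffOp_mul hp hF hφ hc]
    refine Finset.sum_congr rfl fun j _ => integral_congr_ae ?_
    rw [hι]
    filter_upwards [hF1] with x hx
    rw [hx]
  have hz' : Φ z.2 = ∑ j ∈ Finset.range (M + 1), Ψ j (ι z.1) :=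
    closure_minimal hsub hclosed hz
  rw [hΦ, Finset.sum_congr rfl fun j hj => hΨ j hj _] at hz'
  simpa only [hι] using hz'

theorem graph_diffOperator (J : FunctionSpace H) (L : FunctionSpace K) {M : ℕ}
    (p : Fin (M + 1) → ℝ → ℂ) : (diffOperator J L p).graph = diffOpGraph J L p :=
  Submodule.toLinearPMap_graph_eq _ (diffOpGraph_singleValued J L p)

theorem LinearPMap.isClosable_of_forall_mem_closure {f : H →ₗ.[ℂ] K}
    (h : ∀ z ∈ f.graph.topologicalClosure, z.1 = 0 → z.2 = 0) : f.IsClosable :=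
  ⟨_, (Submodule.toLinearPMap_graph_eq _ h).symm⟩

theorem isClosable_opBTilde {J : FunctionSpace H} {L : FunctionSpace K} {M : ℕ}
    (h : CondC2plus L M) {ι : H →L[ℂ] K} (hι : ∀ f, L.toFun (ι f) = J.toFun f)
    {p : Fin (M + 1) → ℝ → ℂ} (hp : ∀ m, ContDiff ℝ M (p m)) (lam : ℂ) :
    (opBTilde J L p lam).IsClosable := by
  refine LinearPMap.isClosable_of_forall_mem_closure fun z hz hz0 => L.injective ?_
  rw [opBTilde, graph_diffOperator] at hz
  have h0 : (J.toFun z.1 : ℝ → ℂ) =ᵐ[volume] fun _ => 0 := by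
    rw [hz0, map_zero]
    exact AEEqFun.coeFn_const (μ := (volume : Measure ℝ)) ℝ (0 : ℂ)
  rw [map_zero]
  refine AEEqFun.ext (EventuallyEq.trans ?_
    (AEEqFun.coeFn_const (μ := (volume : Measure ℝ)) ℝ (0 : ℂ)).symm)
  refine ae_eq_of_forall_integral_contDiff (h.locallyIntegrable _)
    continuous_const.locallyIntegrable fun φ hφ hc => ?_
  rw [integral_mul_eq_of_mem_closure h hι (contDiff_subScalar hp lam) hz hφ hc]
  simp only [Function.const_apply, zero_mul, integral_zero]
  refine Finset.sum_eq_zero fun j _ => ?_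
  rw [← integral_zero ℝ ℂ (μ := volume)]
  refine integral_congr_ae ?_
  filter_upwards [h0] with x hx
  rw [hx, zero_mul]

/-- The continuous map `(f, g) ↦ (f, ιg - λ ιf)` carries one graph into the other, hence closure
into closure. -/
theorem mem_closure_graph_opBTilde {J : FunctionSpace H} {L : FunctionSpace K} {M : ℕ}
    {ι : H →L[ℂ] K} (hι : ∀ f, L.toFun (ι f) = J.toFun f) {p : Fin (M + 1) → ℝ → ℂ} (lam : ℂ)
    {z : H × H} (hz : z ∈ (opATilde J p).graph.topologicalClosure) :
    (z.1, ι z.2 - lam • ι z.1) ∈ (opBTilde J L p lam).graph.topologicalClosure := by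
  let T : H × H → H × K := fun z => (z.1, ι z.2 - lam • ι z.1)
  have hT : Continuous T := by fun_prop
  refine map_mem_closure (f := T) hT hz fun w hw => ?_
  obtain ⟨F, hF, hF1, hF2⟩ := (mem_graph_diffOperator J J p w.1 w.2).mp hw
  refine (mem_graph_diffOperator J L (subScalar p lam) _ _).mpr ⟨F, hF, hF1, ?_⟩
  rw [FunctionSpace.Rep, map_sub, map_smul, hι, hι]
  filter_upwards [AEEqFun.coeFn_sub (J.toFun w.2) (lam • J.toFun w.1),
    AEEqFun.coeFn_smul lam (J.toFun w.1), hF1, hF2] with x h1 h2 h3 h4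
  rw [h1, Pi.sub_apply, h2, Pi.smul_apply, h3, h4, diffOp_subScalar, smul_eq_mul]

theorem isClosable_opATilde {J : FunctionSpace H} {L : FunctionSpace K} {M : ℕ}
    (h : CondC2plus L M) {ι : H →L[ℂ] K} (hι : ∀ f, L.toFun (ι f) = J.toFun f)
    {p : Fin (M + 1) → ℝ → ℂ} (hp : ∀ m, ContDiff ℝ M (p m)) :
    (opATilde J p).IsClosable := by
  refine LinearPMap.isClosable_of_forall_mem_closure fun z hz hz0 => ?_
  have h1 := mem_closure_graph_opBTilde hι 0 hz
  rw [(isClosable_opBTilde h hι hp 0).graph_closure_eq_closure_graph] at h1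
  have h2 : ι z.2 = 0 := by
    simpa using LinearPMap.graph_fst_eq_zero_snd _ h1 hz0
  exact J.injective (by rw [← hι, h2, map_zero, map_zero])

end FunctionSpaces

/-! ### Decay of the coefficients of a test function -/

/-- Transposing the eigenvalue equation gives `μ ∫ E φ = ∫ E (n₀ φ - (n₁ φ)')`, at the cost of one
derivative of the data. The resulting `ψ` depends neither on `E` nor on `μ`, so one functional
serves all basis functions. -/
theorem exists_pow_mul_integral_eq_of_eigen (k : ℕ) {n₁ n₀ φ : ℝ → ℂ} (h₁ : ContDiff ℝ k n₁)
    (h₀ : ContDiff ℝ k n₀) (hφ : ContDiff ℝ k φ) (hc : HasCompactSupport φ) :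
    ∃ ψ : ℝ → ℂ, Continuous ψ ∧ HasCompactSupport ψ ∧ ∀ (E : ℝ → ℂ) (μ : ℂ), ContDiff ℝ 1 E →
      (∀ x, n₁ x * deriv E x + n₀ x * E x = μ * E x) →
        μ ^ k * ∫ x, E x * φ x = ∫ x, E x * ψ x := by
  induction k generalizing φ with
  | zero => exact ⟨φ, hφ.continuous, hc, fun E μ _ _ => by simp⟩
  | succ k ih =>
    have hle : (k : WithTop ℕ∞) ≤ (k + 1 : ℕ) := by exact_mod_cast Nat.le_succ k
    have hle1 : (1 : WithTop ℕ∞) ≤ (k + 1 : ℕ) := by exact_mod_cast Nat.le_add_left 1 k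
    have hprod : ContDiff ℝ (k + 1 : ℕ) (n₁ * φ) := h₁.mul hφ
    have hprodc : HasCompactSupport (n₁ * φ) := hc.mul_left
    have hd : ContDiff ℝ k (deriv (n₁ * φ)) := by
      have : ContDiff ℝ ((k : WithTop ℕ∞) + 1) (n₁ * φ) := by exact_mod_cast hprod
      exact (contDiff_succ_iff_deriv.mp this).2.2
    have hχ : ContDiff ℝ k (n₀ * φ - deriv (n₁ * φ)) :=
      ((h₀.of_le hle).mul (hφ.of_le hle)).sub hd
    have hχc : HasCompactSupport (n₀ * φ - deriv (n₁ * φ)) := by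
      rw [sub_eq_add_neg]
      exact hc.mul_left.add hprodc.deriv.neg
    obtain ⟨ψ, hψ, hψc, hE⟩ := ih (h₁.of_le hle) (h₀.of_le hle) hχ hχc
    refine ⟨ψ, hψ, hψc, fun E μ hEd heig => ?_⟩
    rw [← hE E μ hEd heig, pow_succ, mul_assoc]
    congr 1
    have hEc := hEd.continuous
    have hE' : Continuous (deriv E) := hEd.continuous_deriv le_rfl
    have i1 : Integrable fun x => deriv E x * (n₁ * φ) x :=
      (hE'.mul hprod.continuous).integrable_of_hasCompactSupport hprodc.mul_left
    have i2 : Integrable fun x => E x * (n₀ x * φ x) :=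
      (hEc.mul (h₀.continuous.mul hφ.continuous)).integrable_of_hasCompactSupport
        hc.mul_left.mul_left
    have i3 : Integrable fun x => E x * deriv (n₁ * φ) x :=
      (hEc.mul hd.continuous).integrable_of_hasCompactSupport hprodc.deriv.mul_left
    calc μ * ∫ x, E x * φ x = ∫ x, (deriv E x * (n₁ * φ) x + E x * (n₀ x * φ x)) := by
          rw [← integral_const_mul]
          refine integral_congr_ae (ae_of_all _ fun x => ?_)
          simp only [Pi.mul_apply]
          linear_combination (-φ x) * heig x
      _ = ∫ x, (E x * (n₀ x * φ x) - E x * deriv (n₁ * φ) x) := by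
          rw [integral_add i1 i2, integral_sub i2 i3,
            integral_deriv_mul_eq_neg hEd (hprod.of_le hle1) hprodc]
          ring
      _ = ∫ x, E x * (n₀ * φ - deriv (n₁ * φ)) x := by
          refine integral_congr_ae (ae_of_all _ fun x => ?_)
          simp only [Pi.sub_apply, Pi.mul_apply]
          ring

/-! ### The window argument -/

theorem summable_mul_shift {s t : ℕ → ℝ} (hs : Summable fun n => s n ^ 2)
    (ht : Summable fun n => t n ^ 2) (i j : ℕ) : Summable fun k => |s (k + i) * t (k + j)| := by
  refine Summable.of_nonneg_of_le (fun k => abs_nonneg _) (fun k => ?_)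
    (((summable_nat_add_iff i).mpr hs).add ((summable_nat_add_iff j).mpr ht))
  rw [abs_mul]
  nlinarith [sq_abs (s (k + i)), sq_abs (t (k + j)), sq_nonneg (|s (k + i)| - |t (k + j)|),
    mul_nonneg (abs_nonneg (s (k + i))) (abs_nonneg (t (k + j)))]

/-- If `Λ ≠ 0`, then eventually `a k ≥ ‖Λ‖ / (2k)`, against the divergence of the harmonic series.
-/
theorem eq_zero_of_tendsto_of_summable_div {G : ℕ → ℂ} {Λ : ℂ} (hG : Tendsto G atTop (𝓝 Λ))
    {a : ℕ → ℝ} (ha : Summable a) (h : ∀ᶠ k : ℕ in atTop, ‖G k‖ ≤ k * a k) : Λ = 0 := by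
  by_contra hΛ
  have hpos : 0 < ‖Λ‖ / 2 := by positivity
  have hlow : ∀ᶠ k in atTop, ‖Λ‖ / 2 < ‖G k‖ :=
    hG.norm.eventually (lt_mem_nhds (half_lt_self (norm_pos_iff.mpr hΛ)))
  refine Real.not_summable_one_div_natCast ?_
  refine Summable.of_norm_bounded_eventually_nat (g := fun k => (‖Λ‖ / 2)⁻¹ * a k)
    (ha.mul_left _) ?_
  filter_upwards [h, hlow, eventually_gt_atTop 0] with k h1 h2 h3
  have hk : (0 : ℝ) < k := by exact_mod_cast h3
  rw [Real.norm_of_nonneg (by positivity), ← div_eq_inv_mul, div_le_div_iff₀ hk hpos, one_mul,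
    mul_comm]
  exact h2.le.trans h1

/-- A summation by windows: partial sums over a band matrix that annihilates a square-summable
sequence can only produce a zero limit against coefficients of the complementary decay. -/
theorem eq_zero_of_band {M l : ℕ} {b : ℕ → ℕ → ℂ} (hband : ∀ m n, n + l < m ∨ m + l < n → b m n = 0)
    {C : ℝ} (hC : ∀ m n, 1 ≤ n → ‖b m n‖ ≤ C * (n : ℝ) ^ (M + 1)) {s : ℕ → ℂ}
    (hs : Summable fun n => ‖s n‖ ^ 2) (hV : ∀ m, HasSum (fun n => b m n * s n) 0)
    {τ t : ℕ → ℂ} (ht : Summable fun n => ‖t n‖ ^ 2) {c : ℝ} (hc : 0 < c)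
    (hτ : ∀ᶠ m : ℕ in atTop, c * (m : ℝ) ^ M * ‖τ m‖ ≤ ‖t m‖) {G : ℕ → ℂ}
    (hG : ∀ N, HasSum (fun m => (∑ n ∈ Finset.range N, b m n * s n) * τ m) (G N)) {Λ : ℂ}
    (hΛ : Tendsto G atTop (𝓝 Λ)) : Λ = 0 := by
  have hC0 : 0 ≤ C := by
    have := (norm_nonneg _).trans (hC 0 1 le_rfl)
    simpa using this
  set S : ℕ → ℕ → ℂ := fun N m => ∑ n ∈ Finset.range N, b m n * s n with hS
  -- For such `m` the partial sum already contains the whole band of row `m`, so it equals the full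
  -- sum, which is zero.
  have hlow : ∀ N m, m + l < N → S N m = 0 := by
    intro N m hm
    refine HasSum.unique ?_ (hV m)
    refine hasSum_sum_of_ne_finset_zero fun n hn => ?_
    rw [hband m n (Or.inr (by simp only [Finset.mem_range] at hn; omega)), zero_mul]
  have hhigh : ∀ N m, N + l ≤ m → S N m = 0 := by
    intro N m hm
    refine Finset.sum_eq_zero fun n hn => ?_
    rw [hband m n (Or.inl (by simp only [Finset.mem_range] at hn; omega)), zero_mul]
  -- The cutoff is written as `k + (2l+1)`. A row with nonzero partial sum has `m > k + l`, so only
  -- columns `n ≥ k` contribute; as `k ≥ 1`, the growth bound applies to each of them.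
  have hSb : ∀ k m, 1 ≤ k → ‖S (k + (2 * l + 1)) m‖ ≤
      C * ((k + (2 * l + 1) : ℕ) : ℝ) ^ (M + 1) * ∑ i ∈ Finset.range (2 * l + 1), ‖s (k + i)‖ := by
    intro k m hk
    have hnn : 0 ≤ C * ((k + (2 * l + 1) : ℕ) : ℝ) ^ (M + 1) *
        ∑ i ∈ Finset.range (2 * l + 1), ‖s (k + i)‖ := by positivity
    by_cases hm : m < k + l
    · rw [hlow _ _ (by omega), norm_zero]; exact hnn
    · have e : S (k + (2 * l + 1)) m =
          ∑ i ∈ Finset.range (2 * l + 1), b m (k + i) * s (k + i) := by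
        simp only [hS]
        rw [Finset.sum_range_add, Finset.sum_eq_zero fun n hn => ?_, zero_add]
        rw [hband m n (Or.inl (by simp only [Finset.mem_range] at hn; omega)), zero_mul]
      rw [e, Finset.mul_sum]
      refine norm_sum_le_of_le _ fun i hi => ?_
      rw [norm_mul]
      refine mul_le_mul_of_nonneg_right ((hC m (k + i) (by omega)).trans ?_) (norm_nonneg _)
      have : ((k + i : ℕ) : ℝ) ≤ ((k + (2 * l + 1) : ℕ) : ℝ) := by
        rw [Finset.mem_range] at hi
        exact_mod_cast (by omega : k + i ≤ k + (2 * l + 1))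
      gcongr
  -- The surviving rows lie between `k` and `k + 3l`.
  have hGe : ∀ k, G (k + (2 * l + 1)) =
      ∑ j ∈ Finset.range (3 * l + 1), S (k + (2 * l + 1)) (k + j) * τ (k + j) := by
    intro k
    have h1 : HasSum (fun m => S (k + (2 * l + 1)) m * τ m)
        (∑ m ∈ Finset.range (k + (3 * l + 1)), S (k + (2 * l + 1)) m * τ m) := by
      refine hasSum_sum_of_ne_finset_zero fun m hm => ?_
      rw [hhigh _ _ (by simp only [Finset.mem_range] at hm; omega), zero_mul]
    rw [(hG _).unique h1, Finset.sum_range_add, Finset.sum_eq_zero fun m hm => ?_, zero_add]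
    rw [hlow _ _ (by simp only [Finset.mem_range] at hm; omega), zero_mul]
  set D : ℝ := C * (2 * l + 2 : ℝ) ^ (M + 1) * c⁻¹ with hD
  refine eq_zero_of_tendsto_of_summable_div ((tendsto_add_atTop_iff_nat (2 * l + 1)).mpr hΛ)
    (a := fun k => ∑ j ∈ Finset.range (3 * l + 1), ∑ i ∈ Finset.range (2 * l + 1),
      D * |‖s (k + i)‖ * ‖t (k + j)‖|) ?_ ?_
  · exact summable_sum fun j _ => summable_sum fun i _ =>
      (summable_mul_shift hs ht i j).mul_left D
  · obtain ⟨N₀, hN₀⟩ := eventually_atTop.mp hτ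
    filter_upwards [eventually_ge_atTop N₀, eventually_ge_atTop 1] with k hk hk1
    have hk0 : (0 : ℝ) < k := by exact_mod_cast hk1
    rw [hGe, Finset.mul_sum]
    refine norm_sum_le_of_le _ fun j _ => ?_
    have hτj : ‖τ (k + j)‖ ≤ c⁻¹ * ((k : ℝ) ^ M)⁻¹ * ‖t (k + j)‖ := by
      have h1 := hN₀ (k + j) (by omega)
      have h2 : c * (k : ℝ) ^ M * ‖τ (k + j)‖ ≤ ‖t (k + j)‖ := by
        refine le_trans ?_ h1
        push_cast
        gcongr
        linarith [(Nat.cast_nonneg j : (0 : ℝ) ≤ j)]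
      rw [← mul_inv, ← div_eq_inv_mul, le_div_iff₀ (by positivity), mul_comm]
      exact h2
    -- This makes the growth bound a constant times `k^(M+1)`; against the decay `k^(-M)` exactly
    -- one factor `k` remains.
    have hNk : ((k + (2 * l + 1) : ℕ) : ℝ) ≤ (2 * l + 2) * k := by
      have : k + (2 * l + 1) ≤ (2 * l + 2) * k := by nlinarith
      exact_mod_cast this
    have hnn : 0 ≤ ∑ i ∈ Finset.range (2 * l + 1), ‖s (k + i)‖ := by positivity
    calc ‖S (k + (2 * l + 1)) (k + j) * τ (k + j)‖
        ≤ (C * ((2 * l + 2) * k : ℝ) ^ (M + 1) * ∑ i ∈ Finset.range (2 * l + 1), ‖s (k + i)‖) *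
            (c⁻¹ * ((k : ℝ) ^ M)⁻¹ * ‖t (k + j)‖) := by
          rw [norm_mul]
          refine mul_le_mul ((hSb k (k + j) hk1).trans ?_) hτj (norm_nonneg _) (by positivity)
          gcongr
      _ = k * ∑ i ∈ Finset.range (2 * l + 1), D * |‖s (k + i)‖ * ‖t (k + j)‖| := by
          have e : ∀ i ∈ Finset.range (2 * l + 1), D * |‖s (k + i)‖ * ‖t (k + j)‖| =
              D * ‖t (k + j)‖ * ‖s (k + i)‖ := fun i _ => by
            rw [abs_of_nonneg (by positivity)]; ring
          rw [Finset.sum_congr rfl e, ← Finset.mul_sum, hD, mul_pow, pow_succ (k : ℝ)]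
          field_simp

theorem exists_pos_eventually_mul_le_of_liminf {μ : ℕ → ℝ}
    (h : 0 < liminf (fun n : ℕ => ((|μ n| / (n : ℝ) : ℝ) : EReal)) atTop) :
    ∃ c : ℝ, 0 < c ∧ ∀ᶠ n : ℕ in atTop, c * n ≤ |μ n| := by
  obtain ⟨c, hc0, hc⟩ := EReal.lt_iff_exists_real_btwn.mp h
  refine ⟨c, by exact_mod_cast hc0, ?_⟩
  filter_upwards [eventually_lt_of_lt_liminf hc, eventually_gt_atTop 0] with n hn hn0
  have hn' : (0 : ℝ) < n := by exact_mod_cast hn0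
  exact ((lt_div_iff₀ hn').mp (EReal.coe_lt_coe_iff.mp hn)).le

/-- Riesz representation and Bessel's inequality. -/
theorem HilbertBasis.summable_norm_sq_apply {K : Type*} [NormedAddCommGroup K]
    [InnerProductSpace ℂ K] [CompleteSpace K] (e : HilbertBasis ℕ ℂ K) (Φ : K →L[ℂ] ℂ) :
    Summable fun m => ‖Φ (e m)‖ ^ 2 := by
  have h := e.orthonormal.inner_products_summable ((InnerProductSpace.toDual ℂ K).symm Φ)
  refine h.congr fun m => ?_
  rw [← InnerProductSpace.toDual_symm_apply, norm_inner_symm]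

/-! ### From coefficient sequences to solutions and back -/

section FunctionSpaces

variable {H K : Type*} [NormedAddCommGroup H] [InnerProductSpace ℂ H]
  [NormedAddCommGroup K] [InnerProductSpace ℂ K]

theorem CondC2plus.tendsto_integral {J : FunctionSpace H} {L : FunctionSpace K} {M : ℕ}
    (h : CondC2plus L M) {ι : H →L[ℂ] K} (hι : ∀ f, L.toFun (ι f) = J.toFun f) {χ : ℝ → ℂ}
    (hχ : Continuous χ) (hc : HasCompactSupport χ) {u : ℕ → H} {f : H}
    (hu : Tendsto u atTop (𝓝 f)) :
    Tendsto (fun n => ∫ x, J.toFun (u n) x * χ x) atTop (𝓝 (∫ x, J.toFun f x * χ x)) := by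
  obtain ⟨Φ, hΦ⟩ := h.exists_integral_functional hχ hc
  simp only [← hι, ← hΦ]
  exact ((Φ.continuous.comp ι.continuous).tendsto f).comp hu

theorem continuous_diffOp {M : ℕ} {p : Fin (M + 1) → ℝ → ℂ} (hp : ∀ m, ContDiff ℝ M (p m))
    {F : ℝ → ℂ} (hF : ContDiff ℝ M F) : Continuous (diffOp p F) :=
  continuous_finsetSum _ fun m _ => (hp m).continuous.mul
    (hF.continuous_iteratedDeriv _ (by exact_mod_cast Nat.lt_succ_iff.mp m.2))

/-- Distributional solutions in a function space are classical solutions. -/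
theorem exists_contDiff_diffOp_eq_zero {J : FunctionSpace H} {M : ℕ} {p : Fin (M + 1) → ℝ → ℂ}
    (hp : ∀ m, ContDiff ℝ M (p m)) (hns : ∀ x, p (Fin.last M) x ≠ 0) {f : H}
    (hf : LocallyIntegrable (J.toFun f))
    (h : ∀ φ : ℝ → ℂ, ContDiff ℝ ∞ φ → HasCompactSupport φ → ∑ j ∈ Finset.range (M + 1),
      ∫ x, J.toFun f x * (transposeCoeff p j x * iteratedDeriv j φ x) = 0) :
    ∃ F : ℝ → ℂ, ContDiff ℝ M F ∧ J.Rep f F ∧ ∀ x, diffOp p F x = 0 := by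
  obtain ⟨F, hF, hFe⟩ := exists_contDiff_ae_eq_of_weak hf
    (fun j hj => contDiff_transposeCoeff hp hj)
    (fun x => by
      rw [transposeCoeff_last]
      exact mul_ne_zero (pow_ne_zero _ (by norm_num)) (hns x))
    (fun φ hφ hc => by simpa only [mul_assoc] using h φ hφ hc)
  refine ⟨F, hF, hFe, congrFun ?_⟩
  refine (Continuous.ae_eq_iff_eq (volume : Measure ℝ) (continuous_diffOp hp hF)
    continuous_const).mp (ae_eq_of_forall_integral_contDiff
      (continuous_diffOp hp hF).locallyIntegrable continuous_const.locallyIntegrable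
      fun φ hφ hc => ?_)
  rw [integral_diffOp_mul hp hF hφ hc]
  simp only [zero_mul, integral_zero]
  rw [← h φ hφ hc]
  refine Finset.sum_congr rfl fun j _ => integral_congr_ae ?_
  filter_upwards [hFe] with x hx
  rw [hx]

theorem apply_mem_graph_opBTilde (J : FunctionSpace H) (L : FunctionSpace K) {M : ℕ}
    (p : Fin (M + 1) → ℝ → ℂ) (lam : ℂ) {f : H} (hf : f ∈ (opBTilde J L p lam).domain) :
    (f, opB J L p lam ⟨f, (opBTilde J L p lam).le_closure.1 hf⟩) ∈ (opBTilde J L p lam).graph := by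
  have h : opBTilde J L p lam ⟨f, hf⟩ =
      opB J L p lam ⟨f, (opBTilde J L p lam).le_closure.1 hf⟩ :=
    (opBTilde J L p lam).le_closure.2 rfl
  rw [← h]
  exact LinearPMap.mem_graph _ ⟨f, hf⟩

theorem LinearPMap.exists_mem_domain_iff {f : H →ₗ.[ℂ] K} {x : H} {y : K} :
    (∃ hx : x ∈ f.domain, f ⟨x, hx⟩ = y) ↔ (x, y) ∈ f.graph := by
  rw [LinearPMap.mem_graph_iff]
  constructor
  · rintro ⟨hx, h⟩
    exact ⟨⟨x, hx⟩, rfl, h⟩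
  · rintro ⟨⟨z, hz⟩, h1, h2⟩
    simp only at h1 h2
    subst h1
    exact ⟨hz, h2⟩

/-- The identity of C3 is a closed condition on pairs, so it persists on the closure and gives `⟨f,
C e'_m⟩ = 0`. Expanding `f` in its basis turns this into row `m` of the system. -/
theorem solutionSpace_of_mem_closure {J : FunctionSpace H} {L : FunctionSpace K}
    {e : HilbertBasis ℕ ℂ H} {e' : HilbertBasis ℕ ℂ K} {M : ℕ} {p : Fin (M + 1) → ℝ → ℂ} {lam : ℂ}
    {h1 : CondC1 J L p lam e} (h3 : CondC3 J L p lam e') {f : H}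
    (hf : (f, (0 : K)) ∈ (opBTilde J L p lam).graph.topologicalClosure) :
    (fun n => inner ℂ (e n) f) ∈ solutionSpace (matB J L p lam e e' h1) := by
  obtain ⟨T, -, hT⟩ := h3
  intro m
  obtain ⟨hm, hTm⟩ := hT m
  have hclosed : IsClosed {z : H × K | inner ℂ (e' m) z.2 = inner ℂ (T ⟨e' m, hm⟩) z.1} :=
    isClosed_eq (by fun_prop) (by fun_prop)
  have hsub : ((opBTilde J L p lam).graph : Set (H × K)) ⊆
      {z : H × K | inner ℂ (e' m) z.2 = inner ℂ (T ⟨e' m, hm⟩) z.1} := by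
    intro z hz
    obtain ⟨y, hy1, hy2⟩ := LinearPMap.mem_graph_iff _ |>.mp hz
    rw [Set.mem_ofPred_eq, ← hy1, ← hTm y, ← hy2]
    congr 1
    exact (opBTilde J L p lam).le_closure.2 rfl
  have h0 : inner ℂ (e' m) (0 : K) = inner ℂ (T ⟨e' m, hm⟩) f := closure_minimal hsub hclosed hf
  rw [inner_zero_right] at h0
  have hs := (e.hasSum_repr f).mapL (innerSL ℂ (T ⟨e' m, hm⟩))
  rw [innerSL_apply_apply, ← h0] at hs
  refine hs.congr_fun fun n => ?_
  rw [innerSL_apply_apply, inner_smul_right, e.repr_apply_apply, matB, hTm ⟨e n, h1 n⟩, mul_comm]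

theorem exists_classical_of_solutionSpace [CompleteSpace K] {J : FunctionSpace H} {L : FunctionSpace K}
    {e : HilbertBasis ℕ ℂ H} {e' : HilbertBasis ℕ ℂ K} {M : ℕ} (hM : 1 ≤ M)
    {p : Fin (M + 1) → ℝ → ℂ} (hp : ∀ m, ContDiff ℝ M (p m)) (hns : ∀ x, p (Fin.last M) x ≠ 0)
    {lam : ℂ} {h1 : CondC1 J L p lam e} (h2 : CondC2 (matB J L p lam e e' h1))
    (h2plus : CondC2plus L M) (h21 : CondC21 M (matB J L p lam e e' h1)) (h22 : CondC22 L M e')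
    {ι : H →L[ℂ] K} (hι : ∀ f, L.toFun (ι f) = J.toFun f) {f : H}
    (hf : (fun n => inner ℂ (e n) f) ∈ solutionSpace (matB J L p lam e e' h1)) :
    ∃ F : ℝ → ℂ, ContDiff ℝ M F ∧ J.Rep f F ∧ ∀ x, diffOp p F x = lam * F x := by
  have hlast : ∀ x, subScalar p lam (Fin.last M) x ≠ 0 := fun x => by
    have : Fin.last M ≠ 0 := by
      rw [Ne, Fin.ext_iff, Fin.val_last, Fin.val_zero]; omega
    simpa [subScalar, this] using hns x
  have hfl : LocallyIntegrable (J.toFun f) := by rw [← hι]; exact h2plus.locallyIntegrable _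
  suffices ∃ F : ℝ → ℂ, ContDiff ℝ M F ∧ J.Rep f F ∧ ∀ x, diffOp (subScalar p lam) F x = 0 by
    obtain ⟨F, hF, hFr, hF0⟩ := this
    exact ⟨F, hF, hFr, fun x => sub_eq_zero.mp (by rw [← diffOp_subScalar, hF0])⟩
  refine exists_contDiff_diffOp_eq_zero (contDiff_subScalar hp lam) hlast hfl fun φ hφ hc => ?_
  -- From here on the order is `M + 1`: the functions `n₁`, `n₀` are of class `C^M` and allow `M`
  -- transpositions, one fewer than the order.
  obtain ⟨M, rfl⟩ : ∃ M', M = M' + 1 := ⟨M - 1, by omega⟩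
  obtain ⟨Φ, hΦ⟩ := h2plus.exists_integral_functional hφ.continuous hc
  obtain ⟨E, hE, n₁, n₀, hn₁, hn₀, μ, hμ, hlim⟩ := h22
  obtain ⟨ψ, hψ, hψc, hEψ⟩ := exists_pow_mul_integral_eq_of_eigen M hn₁ hn₀
    (hφ.of_le (by exact_mod_cast le_top)) hc
  obtain ⟨Ψ, hΨ⟩ := h2plus.exists_integral_functional hψ hψc
  obtain ⟨c, hc0, hcμ⟩ := exists_pos_eventually_mul_le_of_liminf hlim
  obtain ⟨l₀, hl₀⟩ := h2
  obtain ⟨C, hC⟩ := h21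
  set s : ℕ → ℂ := fun n => inner ℂ (e n) f with hs
  have hrepr : ∀ n, e.repr f n = s n := fun n => e.repr_apply_apply f n
  set Be : ℕ → K := fun n => opB J L p lam ⟨e n, (opBTilde J L p lam).le_closure.1 (h1 n)⟩ with hBe
  have hgraph : ∀ N, (∑ n ∈ Finset.range N, s n • e n, ∑ n ∈ Finset.range N, s n • Be n) ∈
      (diffOpGraph J L (subScalar p lam)).topologicalClosure := by
    intro N
    refine Submodule.le_topologicalClosure _ ?_
    have : (∑ n ∈ Finset.range N, s n • e n, ∑ n ∈ Finset.range N, s n • Be n) =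
        ∑ n ∈ Finset.range N, s n • (e n, Be n) := by
      simp only [Prod.smul_mk, Prod.ext_iff, Prod.fst_sum, Prod.snd_sum, and_self]
    rw [this]
    refine Submodule.sum_mem _ fun n _ => Submodule.smul_mem _ _ ?_
    rw [← graph_diffOperator]
    exact apply_mem_graph_opBTilde J L p lam (h1 n)
  have hsum : Tendsto (fun N => ∑ n ∈ Finset.range N, s n • e n) atTop (𝓝 f) := by
    have := (e.hasSum_repr f).tendsto_sum_nat
    simpa only [hrepr] using this
  have hmul : ∀ m, μ m ^ M * Φ (e' m) = Ψ (e' m) := by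
    intro m
    have hmE := hEψ (E m) (μ m) ((hE m).1.of_le (by exact_mod_cast Nat.le_add_left 1 M)) (hμ m)
    rw [hΦ, hΨ]
    have e1 : ∀ χ : ℝ → ℂ, ∫ x, L.toFun (e' m) x * χ x = ∫ x, E m x * χ x := fun χ => by
      refine integral_congr_ae ?_
      filter_upwards [(hE m).2] with x hx
      rw [hx]
    rw [e1, e1, hmE]
  -- Here `τ` and `t` are the values on the basis of the functionals given by `φ` and by `ψ`. The
  -- bandwidth `l₀` may be negative, and is then replaced by zero.
  refine eq_zero_of_band (M := M) (l := l₀.toNat) (b := matB J L p lam e e' h1) (C := C) (s := s)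
    (τ := fun m => Φ (e' m)) (t := fun m => Ψ (e' m)) (c := c ^ M)
    (G := fun N => Φ (∑ n ∈ Finset.range N, s n • Be n)) ?_ ?_ ?_ hf
    (e'.summable_norm_sq_apply Ψ) (pow_pos hc0 M) ?_ ?_ ?_
  · intro m n hmn
    refine hl₀ m n ?_
    rw [lt_abs]
    omega
  · intro m n hn
    have hn' : (0 : ℝ) < (n : ℝ) ^ (M + 1) := by
      have : (0 : ℝ) < n := by exact_mod_cast hn
      positivity
    exact (div_le_iff₀ hn').mp (hC m n hn)
  · exact e.orthonormal.inner_products_summable f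
  · filter_upwards [hcμ] with m hm
    rw [← hmul, norm_mul, norm_pow, ← mul_pow, Complex.norm_real, Real.norm_eq_abs]
    gcongr
  · intro N
    have h := (e'.hasSum_repr (∑ n ∈ Finset.range N, s n • Be n)).mapL Φ
    refine h.congr_fun fun m => ?_
    rw [map_smul, smul_eq_mul, e'.repr_apply_apply, inner_sum]
    congr 1
    refine Finset.sum_congr rfl fun n _ => ?_
    rw [inner_smul_right, mul_comm, matB]
  -- Moving the operator onto `φ` removes `B` from the limit: only the convergence of the partial
  -- sums of `f` is needed, not that of their images.
  · have e1 : (fun N => Φ (∑ n ∈ Finset.range N, s n • Be n)) = fun N =>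
        ∑ j ∈ Finset.range (M + 1 + 1), ∫ x, J.toFun (∑ n ∈ Finset.range N, s n • e n) x *
          (transposeCoeff (subScalar p lam) j x * iteratedDeriv j φ x) := by
      ext N
      rw [hΦ]
      exact integral_mul_eq_of_mem_closure h2plus hι (contDiff_subScalar hp lam) (hgraph N) hφ hc
    rw [e1]
    refine tendsto_finsetSum _ fun j hj => h2plus.tendsto_integral hι ?_ ?_ hsum
    · exact (contDiff_transposeCoeff (contDiff_subScalar hp lam)
        (Nat.lt_succ_iff.mp (Finset.mem_range.mp hj))).continuous.mul
        (hφ.iteratedDeriv_infty j).continuous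
    · exact (hc.iteratedDeriv_real j).mul_left

end FunctionSpaces

/-! ### The equivalence -/

theorem mainTheorem7 {H K : Type*}
    [NormedAddCommGroup H] [InnerProductSpace ℂ H] [CompleteSpace H]
    [NormedAddCommGroup K] [InnerProductSpace ℂ K] [CompleteSpace K]
    (J : FunctionSpace H) (L : FunctionSpace K) (hJL : J.Subset L)
    (e : HilbertBasis ℕ ℂ H) (e' : HilbertBasis ℕ ℂ K)
    {M : ℕ} (hM : 1 ≤ M) (p : Fin (M + 1) → ℝ → ℂ) (hp : ∀ m, ContDiff ℝ M (p m))
    (hns : ∀ x, p (Fin.last M) x ≠ 0) (lam : ℂ)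
    (h1 : CondC1 J L p lam e)
    (h2 : CondC2 (matB J L p lam e e' h1))
    (h2plus : CondC2plus L M)
    (h21 : CondC21 M (matB J L p lam e e' h1))
    (h22 : CondC22 L M e')
    (h23 : CondC23 L e')
    (h3 : CondC3 J L p lam e') :
    (opATilde J p).IsClosable ∧ (opBTilde J L p lam).IsClosable ∧
    ∀ f : H, List.TFAE
      [∃ hf : f ∈ (opA J p).domain, opA J p ⟨f, hf⟩ = lam • f,
       ∃ hf : f ∈ (opB J L p lam).domain, opB J L p lam ⟨f, hf⟩ = 0,
       (fun n => inner ℂ (e n) f) ∈ solutionSpace (matB J L p lam e e' h1) ∧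
         Memℓp (fun n => (inner ℂ (e n) f : ℂ)) 2,
       ∃ F : ℝ → ℂ, ContDiff ℝ M F ∧ J.Rep f F ∧ ∀ x, diffOp p F x = lam * F x] := by
  obtain ⟨ι, hι⟩ := hJL.exists_inclusion
  have hA := isClosable_opATilde h2plus hι hp
  have hB := isClosable_opBTilde h2plus hι hp lam
  refine ⟨hA, hB, fun f => ?_⟩
  rw [LinearPMap.exists_mem_domain_iff, LinearPMap.exists_mem_domain_iff, opA, opB,
    ← hA.graph_closure_eq_closure_graph, ← hB.graph_closure_eq_closure_graph]
  tfae_have 1 → 2 := fun h => by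
    simpa only [map_smul, sub_self] using mem_closure_graph_opBTilde hι lam h
  tfae_have 2 → 3 := fun h => by
    refine ⟨solutionSpace_of_mem_closure h3 h, ?_⟩
    rw [show (fun n => inner ℂ (e n) f) = ⇑(e.repr f) from
      funext fun n => (e.repr_apply_apply f n).symm]
    exact lp.memℓp (e.repr f)
  tfae_have 3 → 4 := fun h =>
    exists_classical_of_solutionSpace hM hp hns h2 h2plus h21 h22 hι h.1
  tfae_have 4 → 1 := by
    -- The image `λf` lies in `H` automatically, so `f` is already in the domain before closure.
    rintro ⟨F, hF, hFr, hF0⟩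
    refine Submodule.le_topologicalClosure _
      ((mem_graph_diffOperator J J p f (lam • f)).mpr ⟨F, hF, hFr, ?_⟩)
    rw [FunctionSpace.Rep, map_smul]
    filter_upwards [AEEqFun.coeFn_smul lam (J.toFun f), hFr] with x hx1 hx2
    rw [hx1, Pi.smul_apply, hx2, hF0, smul_eq_mul]
  tfae_finish
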